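/- Let $\mu$ be a partition of $w\ge 0$, drawn in English convention, and let $\mathsf{SYT}(\mu)$ be the set of standard Young tableaux of shape $\mu$ with entries $1,\dots,w$. For $T\in\mathsf{SYT}(\mu)$, an $i\in\{1,\dots,w-1\}$ is a descent if $i+1$ lies in a lower row of $T$ than $i$; $\mathsf{des}(T)$ is the number of descents and $\mathsf{maj}(T)$ is their sum. For $Q\in\mathsf{SYT}(\mu)$ let $P=\mathsf{Ch}(Q)\subseteq[0,1]^w$ be the coarse chamber of $Q$: the set of all $v\in[0,1]^w$ such that RSK row insertion of the word $v_1v_2\cdots v_w$ (an inserted letter $x$ bumps the leftmost entry $>x$ of a row) has recording tableau $Q$. For an integer $h\ge 1$ let $hP=\{hv: v\in P\}$, and let $0P=P\cap\{0\}$; that is, for every $h\ge 0$, $hP$ is the set of points of $[0,h]^w$ with recording tableau $Q$. Put $u=(1,\dots,1)$ and define the quantum Ehrhart series of $P$ by $$\mathsf{QEhr}_P(z,q)=\sum_{h\ge 0}\Big(\sum_{v} q^{2\langle u,v\rangle}\Big)z^h,$$ where the inner sum is over all $v\in\big(hP-\tfrac h2u\big)\cap\big(\tfrac h2+\mathbb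 Z\big)^w$. Let $s_\mu[s_h](q^{-1},q)$ be the plethysm of the Schur function $s_\mu$ with $s_h=s_{(h)}$ in two variables, evaluated at $(q^{-1},q)$, where $s_\mu[g]$, for a polynomial $g$ that is a sum of monomials, is obtained by substituting the monomials of $g$ (with multiplicity) for the variables of $s_\mu$. Then for every $Q\in\mathsf{SYT}(\mu)$, with $P=\mathsf{Ch}(Q)$, the following identities of power series in $z$ over $\mathbb Z[q,q^{-1}]$ hold: $$\mathsf{QEhr}_P(z,q)=\sum_{h\ge 0}s_\mu[s_h](q^{-1},q)\,z^h=\frac{\sum_{T\in\mathsf{SYT}(\mu)}q^{-2\,\mathsf{maj}(T)}\,(zq^w)^{\mathsf{des}(T)}}{\prod_{i=0}^{w}\big(1-q^{w-2i}z\big)}.$$ -/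

import Mathlib

open scoped Pointwise

noncomputable section

namespace QuantumEhrhart

/-! ### Standard Young tableaux, descents, major index -/

/-- A tableau of shape `μ` is standard if its entries are `1, 2, …, |μ|`, each occurring once. -/
def IsStandard {μ : YoungDiagram} (T : SemistandardYoungTableau μ) : Prop :=
  Set.BijOn (fun c : ℕ × ℕ => T c.1 c.2) (μ.cells : Set (ℕ × ℕ)) (Set.Icc 1 μ.card)

/-- The standard Young tableaux of shape `μ` (English convention: the cell `(i, j)` is in row `i`,
counted from the top, and column `j`; entries outside `μ` are `0`). -/
def SYT (μ : YoungDiagram) : Type := {T : SemistandardYoungTableau μ // IsStandard T}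

/-- The semistandard Young tableaux of shape `μ` over the alphabet `{0, 1, …, n - 1}`. -/
def SSYTBelow (n : ℕ) (μ : YoungDiagram) : Type :=
  {T : SemistandardYoungTableau μ // ∀ c ∈ μ.cells, T c.1 c.2 < n}

instance finite_SSYTBelow (n : ℕ) (μ : YoungDiagram) : Finite (SSYTBelow n μ) := by
  refine Finite.of_injective
    (fun (T : SSYTBelow n μ) (c : μ.cells) => (⟨T.1 c.1.1 c.1.2, T.2 c.1 c.2⟩ : Fin n)) ?_
  intro T T' h
  apply Subtype.ext
  ext i j
  by_cases hc : (i, j) ∈ μ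
  · have := congrFun h ⟨(i, j), hc⟩
    simpa using this
  · rw [T.1.zeros hc, T'.1.zeros hc]

instance finite_SYT (μ : YoungDiagram) : Finite (SYT μ) := by
  refine Finite.of_injective (β := SSYTBelow (μ.card + 1) μ)
    (fun T => ⟨T.1, fun c hc => Nat.lt_succ_of_le (T.2.mapsTo hc).2⟩) ?_
  intro T T' h
  exact Subtype.ext (congrArg (fun S : SSYTBelow (μ.card + 1) μ => S.1) h)

instance (n : ℕ) (μ : YoungDiagram) : Fintype (SSYTBelow n μ) := Fintype.ofFinite _

instance (μ : YoungDiagram) : Fintype (SYT μ) := Fintype.ofFinite _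

/-- `i` is a descent of `T` if `i + 1` appears in a lower row (larger row index) than `i`. -/
def descents {μ : YoungDiagram} (T : SYT μ) : Finset ℕ :=
  (Finset.Icc 1 μ.card).filter fun i =>
    ∃ c ∈ μ.cells, ∃ d ∈ μ.cells, T.1 c.1 c.2 = i ∧ T.1 d.1 d.2 = i + 1 ∧ c.1 < d.1

/-- The number of descents of `T`. -/
def des {μ : YoungDiagram} (T : SYT μ) : ℕ := (descents T).card

/-- The major index of `T`, the sum of its descents. -/
def maj {μ : YoungDiagram} (T : SYT μ) : ℕ := ∑ i ∈ descents T, i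

/-! ### Schur polynomials and plethysm -/

/-- The Schur polynomial `s_μ` in `n` variables, as the generating function of the semistandard
tableaux of shape `μ` over an `n`-letter alphabet. -/
def schurPoly (n : ℕ) (μ : YoungDiagram) : MvPolynomial (Fin n) ℕ :=
  ∑ T : SSYTBelow n μ, ∏ c : μ.cells, MvPolynomial.X ⟨T.1 c.1.1 c.1.2, T.2 c.1 c.2⟩

/-- The (exponents of the) monomials of `g`, each repeated as often as its coefficient says,
in decreasing lexicographic order. -/
def monomialList {n : ℕ} (g : MvPolynomial (Fin n) ℕ) : List (Fin n →₀ ℕ) :=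
  ((g.support.map toLex.toEmbedding).sort (· ≥ ·)).flatMap
    fun d => List.replicate (g.coeff (ofLex d)) (ofLex d)

/-- The plethysm `s_μ[g]` of the Schur function `s_μ` with a polynomial `g` that is a sum of
monomials: the monomials of `g`, with multiplicity, are substituted for the variables of `s_μ`.
(As `s_μ` is symmetric, the order in which they are listed does not matter.) -/
def plethysm (μ : YoungDiagram) {n : ℕ} (g : MvPolynomial (Fin n) ℕ) : MvPolynomial (Fin n) ℕ :=
  MvPolynomial.aeval
    (fun i : Fin (monomialList g).length => MvPolynomial.monomial ((monomialList g).get i) 1)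
    (schurPoly (monomialList g).length μ)

/-- The Young diagram of the one-row partition `(h)` (empty for `h = 0`). -/
def oneRow (h : ℕ) : YoungDiagram where
  cells := {0} ×ˢ Finset.range h
  isLowerSet := by
    rintro ⟨i, j⟩ ⟨i', j'⟩ ⟨h1, h2⟩ hm
    simp only [Finset.coe_product, Finset.coe_singleton, Finset.coe_range, Set.mem_prod,
      Set.mem_singleton_iff, Set.mem_Iio] at hm ⊢
    simp only at h1 h2
    omega

/-- The Laurent polynomial `q ^ n`. -/
def qPow (n : ℤ) : LaurentPolynomial ℤ := LaurentPolynomial.T n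

/-- `s_μ[s_h](q⁻¹, q)`: the plethysm of `s_μ` with `s_h = s_{(h)}` in two variables,
evaluated at `(q⁻¹, q)`. -/
def sl2Plethysm (μ : YoungDiagram) (h : ℕ) : LaurentPolynomial ℤ :=
  MvPolynomial.aeval ![qPow (-1), qPow 1] (plethysm μ (schurPoly 2 (oneRow h)))

/-! ### The Robinson–Schensted–Knuth correspondence for words over a linear order -/

section RSK

variable {α : Type} [LinearOrder α]

/-- Row insertion of `x`: `x` replaces the leftmost entry greater than `x`, which is bumped
(second component), or is appended to the row if there is no such entry. -/
def rowInsert (x : α) : List α → List α × Option α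
  | [] => ([x], none)
  | y :: ys => if x < y then (x :: ys, some y) else (y :: (rowInsert x ys).1, (rowInsert x ys).2)

/-- One RSK step on a pair (insertion tableau, recording tableau), each given by its list of rows:
`x` is inserted into the first row of the insertion tableau, a bumped entry is inserted into the
next row, and so on; the cell by which the insertion tableau grows gets the label `k` in the
recording tableau. -/
def rskInsert (x : α) (k : ℕ) : List (List α) → List (List ℕ) → List (List α) × List (List ℕ)
  | [], _ => ([[x]], [[k]])
  | r :: rs, qs =>
    match rowInsert x r with
    | (r', none) => (r' :: rs, (qs.headD [] ++ [k]) :: qs.tail)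
    | (r', some y) =>
      (r' :: (rskInsert y k rs qs.tail).1, qs.headD [] :: (rskInsert y k rs qs.tail).2)

/-- The pair (insertion tableau, recording tableau) of the word `v₁ v₂ ⋯ v_w`; the recording
tableau has the labels `1, …, w`. -/
def rsk {w : ℕ} (v : Fin w → α) : List (List α) × List (List ℕ) :=
  (List.finRange w).foldl (fun t i => rskInsert (v i) (i + 1) t.1 t.2) ([], [])

/-- The entry of the recording tableau `RSK(v)₂` in the cell `(i, j)`, `0` if there is no such
cell. -/
def recordingEntry {w : ℕ} (v : Fin w → α) (i j : ℕ) : ℕ :=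
  ((rsk v).2.getD i []).getD j 0

end RSK

/-! ### Coarse chambers and the quantum Ehrhart series -/

/-- The unit cube `[0, 1]^w`. -/
def cube (w : ℕ) : Set (Fin w → ℝ) := {v | ∀ i, 0 ≤ v i ∧ v i ≤ 1}

/-- The coarse chamber `Ch(Q)`: the points of the cube whose recording tableau under RSK is `Q`. -/
def coarseChamber {μ : YoungDiagram} (Q : SYT μ) : Set (Fin μ.card → ℝ) :=
  {v | v ∈ cube μ.card ∧ ∀ i j, recordingEntry v i j = Q.1 i j}

/-- The dilate `h P` of a set `P` which, like the chambers, is cut out of the unit cube by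
homogeneous weak and strict inequalities. The dilate consists of the points of the `h`-fold cube
that satisfy the same inequalities. So for `h ≥ 1` it is `{h v | v ∈ P}`, and for `h = 0` it
contains at most the origin, namely if the origin is in `P`. -/
def dilate {w : ℕ} (h : ℕ) (P : Set (Fin w → ℝ)) : Set (Fin w → ℝ) :=
  if h = 0 then P ∩ {0} else (h : ℝ) • P

/-- The dilate `h P̃ = h P - (h/2) u` of the centered set `P̃ = P - u/2`, where `u = (1, …, 1)`. -/
def centeredDilate {w : ℕ} (h : ℕ) (P : Set (Fin w → ℝ)) : Set (Fin w → ℝ) :=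
  (fun v i => v i - (h : ℝ) / 2) '' dilate h P

/-- The lattice `𝓛_h = (h/2 + ℤ)^w`. -/
def shiftedLattice (w h : ℕ) : Set (Fin w → ℝ) :=
  {v | ∀ i, ∃ m : ℤ, v i = (h : ℝ) / 2 + m}

/-- The set over which the sum in `quantumEhrhart` runs is finite for `P` in the unit cube. -/
theorem finite_centeredDilate_inter {w : ℕ} (h : ℕ) {P : Set (Fin w → ℝ)} (hP : P ⊆ cube w) :
    (centeredDilate h P ∩ shiftedLattice w h).Finite := by
  have hd : ∀ v ∈ dilate h P, ∀ i, 0 ≤ v i ∧ v i ≤ h := by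
    intro v hv i
    unfold dilate at hv
    split_ifs at hv with h0
    · have : v = 0 := hv.2
      simp [this]
    · obtain ⟨p, hp, rfl⟩ := hv
      have := hP hp i
      have hh : (0 : ℝ) ≤ h := Nat.cast_nonneg h
      simp only [Pi.smul_apply, smul_eq_mul]
      exact ⟨mul_nonneg hh this.1, by nlinarith [this.2]⟩
  refine Set.Finite.subset (Set.Finite.pi' (t := fun _ : Fin w =>
    (fun m : ℤ => (h : ℝ) / 2 + m) '' Set.Icc (-(h : ℤ)) h)
    (fun _ => (Set.finite_Icc _ _).image _)) ?_
  rintro _ ⟨⟨v, hv, rfl⟩, hl⟩ i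
  obtain ⟨m, hm⟩ := hl i
  have := hd v hv i
  refine ⟨m, ⟨?_, ?_⟩, hm.symm⟩
  · have : (-(h : ℝ)) ≤ m := by linarith
    exact_mod_cast this
  · have h0 : (0 : ℝ) ≤ h := Nat.cast_nonneg h
    have : (m : ℝ) ≤ h := by linarith
    exact_mod_cast this

/-- The quantum Ehrhart polynomial `∑ q ^ (2 ⟨u, v⟩)`, over the points `v` of `h P̃` in the lattice
`𝓛_h`. There `2 ⟨u, v⟩ = 2 (v₁ + ⋯ + v_w)` is an integer, so the floor changes nothing. -/
def quantumEhrhart {w : ℕ} (P : Set (Fin w → ℝ)) (h : ℕ) : LaurentPolynomial ℤ :=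
  ∑ᶠ v ∈ centeredDilate h P ∩ shiftedLattice w h, qPow ⌊2 * ∑ i, v i⌋

/-- The quantum Ehrhart series, a power series in `z` over the Laurent polynomials in `q`. -/
def quantumEhrhartSeries {w : ℕ} (P : Set (Fin w → ℝ)) : PowerSeries (LaurentPolynomial ℤ) :=
  PowerSeries.mk fun h => quantumEhrhart P h

/-- The numerator `∑_T q ^ (-2 maj T) (z q ^ w) ^ (des T)` over the standard tableaux `T` of shape
`μ`, where `w = |μ|`. -/
def numerator (μ : YoungDiagram) : PowerSeries (LaurentPolynomial ℤ) :=
  ∑ T : SYT μ, PowerSeries.C (qPow (-2 * (maj T : ℤ))) *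
    (PowerSeries.X * PowerSeries.C (qPow (μ.card : ℤ))) ^ des T

/-- The denominator `∏_{i=0}^w (1 - q ^ (w - 2 i) z)`. -/
def denominator (w : ℕ) : PowerSeries (LaurentPolynomial ℤ) :=
  ∏ i ∈ Finset.range (w + 1),
    (1 - PowerSeries.C (qPow ((w : ℤ) - 2 * (i : ℤ))) * PowerSeries.X)

/-- The denominator has constant term `1`, so `PowerSeries.invOfUnit _ 1` is its inverse. -/
theorem denominator_mul_invOfUnit (w : ℕ) :
    denominator w * PowerSeries.invOfUnit (denominator w) 1 = 1 :=
  PowerSeries.mul_invOfUnit _ _ (by simp [denominator, map_prod])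

end QuantumEhrhart

end

/-!
Three expressions are identified with the principal specialization `principalSchur μ h`, the sum of
`q ^ (2 |T| - h |μ|)` over the semistandard tableaux `T` of shape `μ` with entries at most `h`, where
`|T|` is the sum of the entries.

*Quantum Ehrhart series.* Row insertion only compares letters, so the lattice points of the `h`-fold
dilate of `Ch(Q)` are the words of length `|μ|` over `{0, …, h}` with recording tableau `Q`
(`centeredDilate_inter_eq`). By the Robinson–Schensted–Knuth bijection, the insertion tableau
identifies them with the semistandard tableaux of shape `μ` over the same alphabet, and it has the
letters of the word as its entries (`rsk_injective`, `exists_rsk_eq`, `rsk_fst_flatten_perm`). The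
bijection is built letter by letter: Schensted insertion is inverted row by row, and the only point
to check is that reverse row insertion keeps the columns strict (`Above.exists_rowInsert_eq`).

*Plethysm.* The monomials of `s_h(x₀, x₁)` are `x₀ʰ⁻ᵏ x₁ᵏ` for `0 ≤ k ≤ h`, in decreasing
lexicographic order, and `x₀ʰ⁻ᵏ x₁ᵏ` has the value `q ^ (2 k - h)` at `(q⁻¹, q)`. So
`s_μ[s_h](q⁻¹, q)` is `principalSchur μ h` term by term (`sl2Plethysm_eq`).

*Rational form.* A semistandard tableau is obtained in exactly one way by replacing the entries
`1, …, w` of a standard tableau `S` by the terms of a sequence `a₁ ≤ ⋯ ≤ a_w ≤ h` that increases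
strictly at the descents of `S` (`principalSchur_eq_sum`). For a fixed descent set `D`, let `F_w(z)`
be the generating function of these sequences, with `z` marking the bound `h` and `q ^ 2` the sum.
Splitting off the last term gives `F_{w+1}(z) = (1 - z)⁻¹ G(q² z)`, where `G(z)` is `z F_w(z)` or
`F_w(z)` according to whether `w ∈ D` or not (`compatibleSeries_succ`). By induction `F_w(z)` is a
product (`compatibleSeries_mul`), and replacing `z` by `q⁻ʷ z` turns it into the contribution of `S`
to the numerator divided by the denominator (`mk_principalSchur_mul_denominator`).
-/

namespace QuantumEhrhart

/-! ### Row insertion -/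

section RowInsertion

variable {α : Type} [LinearOrder α]

theorem rowInsert_eq_append {x : α} {r : List α} (h : ∀ a ∈ r, a ≤ x) :
    rowInsert x r = (r ++ [x], none) := by
  induction r with
  | nil => rfl
  | cons a r ih =>
    rw [List.forall_mem_cons] at h
    simp [rowInsert, ih h.2, not_lt.2 h.1]

theorem rowInsert_eq_none {x : α} {r t : List α} (h : rowInsert x r = (t, none)) :
    t = r ++ [x] ∧ ∀ a ∈ r, a ≤ x := by
  induction r generalizing t with
  | nil => simp_all [rowInsert]
  | cons a r ih =>
    unfold rowInsert at h
    split_ifs at h with hx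
    · simp at h
    · simp only [Prod.mk.injEq] at h
      obtain ⟨rfl, h2⟩ := h
      obtain ⟨h3, h4⟩ := ih (t := (rowInsert x r).1) (Prod.ext rfl h2)
      exact ⟨by rw [h3]; rfl, List.forall_mem_cons.2 ⟨not_lt.1 hx, h4⟩⟩

theorem rowInsert_eq_some {x y : α} {r t : List α} (h : rowInsert x r = (t, some y)) :
    x < y ∧ (y :: t).Perm (x :: r) := by
  induction r generalizing t with
  | nil => simp [rowInsert] at h
  | cons a r ih =>
    unfold rowInsert at h
    split_ifs at h with hx
    · simp only [Prod.mk.injEq, Option.some.injEq] at h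
      obtain ⟨rfl, rfl⟩ := h
      exact ⟨hx, List.Perm.swap ..⟩
    · simp only [Prod.mk.injEq] at h
      obtain ⟨rfl, h2⟩ := h
      obtain ⟨h3, h4⟩ := ih (t := (rowInsert x r).1) (Prod.ext rfl h2)
      exact ⟨h3, (List.Perm.swap ..).trans ((h4.cons a).trans (List.Perm.swap ..))⟩

theorem length_eq_of_rowInsert_eq_some {x y : α} {r t : List α}
    (h : rowInsert x r = (t, some y)) : t.length = r.length := by
  simpa using (rowInsert_eq_some h).2.length_eq

theorem mem_of_mem_rowInsert {x a : α} {r : List α} (h : a ∈ (rowInsert x r).1) :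
    a = x ∨ a ∈ r := by
  induction r with
  | nil => simpa [rowInsert] using h
  | cons b r ih =>
    unfold rowInsert at h
    split_ifs at h with hx
    · simp only [List.mem_cons] at h ⊢
      tauto
    · simp only [List.mem_cons] at h ⊢
      tauto

theorem mem_rowInsert_self (x : α) (r : List α) : x ∈ (rowInsert x r).1 := by
  induction r with
  | nil => simp [rowInsert]
  | cons b r ih =>
    unfold rowInsert
    split_ifs <;> simp [ih]

theorem pairwise_rowInsert (x : α) {r : List α} (hr : r.Pairwise (· ≤ ·)) :
    (rowInsert x r).1.Pairwise (· ≤ ·) := by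
  induction r with
  | nil => simp [rowInsert]
  | cons b r ih =>
    rw [List.pairwise_cons] at hr
    unfold rowInsert
    split_ifs with hx
    · exact List.pairwise_cons.2 ⟨fun a ha => hx.le.trans (hr.1 a ha), hr.2⟩
    · refine List.pairwise_cons.2 ⟨fun a ha => ?_, ih hr.2⟩
      rcases mem_of_mem_rowInsert ha with rfl | ha
      · exact not_lt.1 hx
      · exact hr.1 a ha

/-- A row insertion that bumps an entry can be undone. -/
theorem rowInsert_injective {x x' y : α} {r r' t : List α} (hr : r.Pairwise (· ≤ ·))
    (hr' : r'.Pairwise (· ≤ ·)) (h : rowInsert x r = (t, some y))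
    (h' : rowInsert x' r' = (t, some y)) : x = x' ∧ r = r' := by
  induction r generalizing r' t with
  | nil => simp [rowInsert] at h
  | cons a r ih =>
    cases r' with
    | nil => simp [rowInsert] at h'
    | cons a' r' =>
      have hxy := (rowInsert_eq_some h).1
      have hxy' := (rowInsert_eq_some h').1
      rw [List.pairwise_cons] at hr hr'
      unfold rowInsert at h h'
      split_ifs at h h' with h1 h2 h2
      · simp only [Prod.mk.injEq, Option.some.injEq] at h h'
        obtain ⟨rfl, rfl⟩ := h
        obtain ⟨h3, rfl⟩ := h'
        simp_all
      · simp only [Prod.mk.injEq, Option.some.injEq] at h h'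
        obtain ⟨rfl, rfl⟩ := h
        simp only [List.cons.injEq] at h'
        have := mem_rowInsert_self x' r'
        rw [h'.1.2] at this
        exact absurd (hr.1 _ this) (not_le.2 hxy')
      · simp only [Prod.mk.injEq, Option.some.injEq] at h h'
        obtain ⟨rfl, rfl⟩ := h'
        simp only [List.cons.injEq] at h
        have := mem_rowInsert_self x r
        rw [h.1.2] at this
        exact absurd (hr'.1 _ this) (not_le.2 hxy)
      · simp only [Prod.mk.injEq] at h h'
        obtain ⟨rfl, h3⟩ := h
        simp only [List.cons.injEq] at h'
        obtain ⟨h5, h6⟩ := ih hr.2 hr'.2 (t := (rowInsert x r).1) (Prod.ext rfl h3)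
          (Prod.ext h'.1.2 h'.2)
        exact ⟨h5, by rw [h'.1.1, h6]⟩

/-- `Above r s` means that the row `s` may stand directly below the row `r` in a semistandard
tableau: `s` is no longer than `r`, and its entries exceed those above them. -/
def Above : List α → List α → Prop
  | _, [] => True
  | [], _ :: _ => False
  | a :: r, b :: s => a < b ∧ Above r s

@[simp] theorem above_nil (r : List α) : Above r [] := by cases r <;> trivial

theorem above_iff {r s : List α} : Above r s ↔
    s.length ≤ r.length ∧ ∀ (j : ℕ) (hr : j < r.length) (hs : j < s.length), r[j] < s[j] := by
  induction r generalizing s with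
  | nil => cases s <;> simp [Above]
  | cons a r ih =>
    cases s with
    | nil => simp
    | cons b s =>
      simp only [Above, ih, List.length_cons]
      constructor
      · rintro ⟨h1, h2, h3⟩
        refine ⟨by omega, fun j hr hs => ?_⟩
        cases j with
        | zero => simpa using h1
        | succ j => simpa using h3 j (by omega) (by omega)
      · rintro ⟨h1, h2⟩
        refine ⟨by simpa using h2 0 (by omega) (by omega), by omega, fun j hr hs => ?_⟩
        exact h2 (j + 1) (by omega) (by omega)

theorem Above.append {r s : List α} (h : Above r s) (t : List α) : Above (r ++ t) s := by
  rw [above_iff] at h ⊢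
  refine ⟨by simp; omega, fun j hr hs => ?_⟩
  rw [List.getElem_append_left (by omega)]
  exact h.2 _ _ _

theorem Above.of_append {r s t : List α} (h : Above (r ++ t) s) (hl : s.length ≤ r.length) :
    Above r s := by
  rw [above_iff] at h ⊢
  refine ⟨hl, fun j hr hs => ?_⟩
  have := h.2 j (by simp; omega) hs
  rwa [List.getElem_append_left hr] at this

theorem Above.of_append_right {r s t : List α} (h : Above r (s ++ t)) : Above r s := by
  rw [above_iff] at h ⊢
  obtain ⟨h1, h2⟩ := h
  rw [List.length_append] at h1
  refine ⟨by omega, fun j hr hs => ?_⟩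
  have := h2 j hr (by simp; omega)
  rwa [List.getElem_append_left hs] at this

theorem Above.rowInsert_left {x : α} {r s : List α} (h : Above r s) :
    Above (rowInsert x r).1 s := by
  induction r generalizing s with
  | nil =>
    cases s with
    | nil => simp
    | cons b s => exact h.elim
  | cons a r ih =>
    cases s with
    | nil => simp
    | cons b s =>
      unfold rowInsert
      split_ifs with hx
      · exact ⟨hx.trans h.1, h.2⟩
      · exact ⟨h.1, ih h.2⟩

/-- Inserting into the next row the entry bumped from a row keeps the columns strict. -/
theorem Above.rowInsert {x y : α} {r s t : List α} (h : Above r s) (hr : r.Pairwise (· ≤ ·))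
    (hx : rowInsert x r = (t, some y)) : Above t (rowInsert y s).1 := by
  induction r generalizing s t with
  | nil => simp [QuantumEhrhart.rowInsert] at hx
  | cons a r ih =>
    have hxy := (rowInsert_eq_some hx).1
    rw [List.pairwise_cons] at hr
    unfold QuantumEhrhart.rowInsert at hx
    split_ifs at hx with hxa
    · simp only [Prod.mk.injEq, Option.some.injEq] at hx
      obtain ⟨rfl, rfl⟩ := hx
      cases s with
      | nil => exact ⟨hxa, above_nil _⟩
      | cons b s =>
        rw [QuantumEhrhart.rowInsert, if_pos h.1]
        exact ⟨hxa, h.2⟩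
    · simp only [Prod.mk.injEq] at hx
      obtain ⟨rfl, h2⟩ := hx
      have hay : a < y := (not_lt.1 hxa).trans_lt hxy
      cases s with
      | nil => exact ⟨hay, above_nil _⟩
      | cons b s =>
        rw [QuantumEhrhart.rowInsert]
        split_ifs with hyb
        · exact ⟨hay, h.2.rowInsert_left⟩
        · exact ⟨h.1, ih h.2 hr.2 (Prod.ext rfl h2)⟩

/-- Reverse row insertion: `y` replaces the rightmost entry less than `y`. -/
theorem exists_rowInsert_eq {y a : α} {r : List α} (hr : (a :: r).Pairwise (· ≤ ·)) (hy : a < y) :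
    ∃ x r', r'.Pairwise (· ≤ ·) ∧ rowInsert x r' = (a :: r, some y) ∧
      ∀ s, Above (a :: r) s → (∀ b ∈ s, y < b) → Above r' s := by
  induction r generalizing a with
  | nil =>
    refine ⟨a, [y], by simp, by simp [rowInsert, hy], fun s hs hb => ?_⟩
    cases s with
    | nil => simp
    | cons b s => exact ⟨hb b (by simp), hs.2⟩
  | cons c r ih =>
    rw [List.pairwise_cons] at hr
    by_cases hc : c < y
    · obtain ⟨x, r', h1, h2, h3⟩ := ih hr.2 hc
      have hxc : x ∈ c :: r := by
        have := mem_rowInsert_self x r'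
        rwa [h2] at this
      refine ⟨x, a :: r', List.pairwise_cons.2 ⟨fun b hb => ?_, h1⟩, ?_, fun s hs hb => ?_⟩
      · have : b ∈ y :: c :: r := (rowInsert_eq_some h2).2.symm.subset (List.mem_cons_of_mem _ hb)
        rcases List.mem_cons.1 this with rfl | hb'
        · exact hy.le
        · exact hr.1 b hb'
      · rw [rowInsert, if_neg (not_lt.2 (hr.1 x hxc)), h2]
      · cases s with
        | nil => simp
        | cons b s => exact ⟨hs.1, h3 s hs.2 fun b' hb' => hb b' (by simp [hb'])⟩
    -- `a` is the rightmost entry less than `y`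
    · refine ⟨a, y :: c :: r, List.pairwise_cons.2 ⟨fun b hb => ?_, hr.2⟩,
        by rw [rowInsert, if_pos hy], fun s hs hb => ?_⟩
      · rcases List.mem_cons.1 hb with rfl | hb'
        · exact not_lt.1 hc
        · exact (not_lt.1 hc).trans ((List.pairwise_cons.1 hr.2).1 b hb')
      · cases s with
        | nil => simp
        | cons b s => exact ⟨hb b (by simp), hs.2⟩

/-- Reverse row insertion keeps the columns strict. -/
theorem Above.exists_rowInsert_eq {y : α} {r s : List α} (hr : r.Pairwise (· ≤ ·))
    (hs : s.Pairwise (· ≤ ·)) (h : Above r (QuantumEhrhart.rowInsert y s).1) :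
    ∃ x r', r'.Pairwise (· ≤ ·) ∧ QuantumEhrhart.rowInsert x r' = (r, some y) ∧ Above r' s := by
  induction r generalizing s with
  | nil =>
    have hy := mem_rowInsert_self y s
    cases hs' : (QuantumEhrhart.rowInsert y s).1 with
    | nil => simp [hs'] at hy
    | cons b t => rw [hs'] at h; exact h.elim
  | cons a r ih =>
    cases s with
    | nil =>
      obtain ⟨x, r', h1, h2, -⟩ := QuantumEhrhart.exists_rowInsert_eq hr h.1
      exact ⟨x, r', h1, h2, above_nil _⟩
    | cons b s =>
      rw [List.pairwise_cons] at hs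
      rw [QuantumEhrhart.rowInsert] at h
      split_ifs at h with hyb
      -- `y` is less than every entry of `b :: s`, so it may stand above any of them
      · have hall : ∀ c ∈ b :: s, y < c := by
          intro c hc
          rcases List.mem_cons.1 hc with rfl | hc
          · exact hyb
          · exact hyb.trans_le (hs.1 c hc)
        obtain ⟨x, r', h1, h2, h3⟩ := QuantumEhrhart.exists_rowInsert_eq hr h.1
        exact ⟨x, r', h1, h2, h3 _ ⟨h.1.trans hyb, h.2⟩ hall⟩
      · rw [List.pairwise_cons] at hr
        obtain ⟨x, r', h1, h2, h3⟩ := ih hr.2 hs.2 h.2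
        have hx : x ∈ r := by
          have := mem_rowInsert_self x r'
          rwa [h2] at this
        have hay : a < y := h.1.trans_le (not_lt.1 hyb)
        refine ⟨x, a :: r', List.pairwise_cons.2 ⟨fun c hc => ?_, h1⟩, ?_, h.1, h3⟩
        · have : c ∈ y :: r := (rowInsert_eq_some h2).2.symm.subset (List.mem_cons_of_mem _ hc)
          rcases List.mem_cons.1 this with rfl | hc'
          · exact hay.le
          · exact hr.1 c hc'
        · rw [QuantumEhrhart.rowInsert, if_neg (not_lt.2 (hr.1 x hx)), h2]

end RowInsertion

/-! ### Insertion into a tableau -/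

section Insertion

variable {α : Type} [LinearOrder α]

/-- A semistandard tableau, given by the list of its rows, none of which is empty. -/
def IsTableau : List (List α) → Prop
  | [] => True
  | r :: rs => r ≠ [] ∧ r.Pairwise (· ≤ ·) ∧ Above r (rs.headD []) ∧ IsTableau rs

/-- Schensted insertion of `x` into a tableau: the new tableau and the index of the row in which
the new cell lies. -/
def schensted (x : α) : List (List α) → List (List α) × ℕ
  | [] => ([[x]], 0)
  | r :: rs =>
    match rowInsert x r with
    | (r', none) => (r' :: rs, 0)
    | (r', some y) => (r' :: (schensted y rs).1, (schensted y rs).2 + 1)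

/-- `addCell T i k` appends the entry `k` to the row of `T` with index `i`, which may be the row
below the last one. -/
def addCell {β : Type} : List (List β) → ℕ → β → List (List β)
  | T, 0, k => (T.headD [] ++ [k]) :: T.tail
  | T, i + 1, k => T.headD [] :: addCell T.tail i k

theorem schensted_cons_of_none {x : α} {r r' : List α} {rs : List (List α)}
    (h : rowInsert x r = (r', none)) : schensted x (r :: rs) = (r' :: rs, 0) := by
  rw [schensted, h]

theorem schensted_cons_of_some {x y : α} {r r' : List α} {rs : List (List α)}
    (h : rowInsert x r = (r', some y)) :
    schensted x (r :: rs) = (r' :: (schensted y rs).1, (schensted y rs).2 + 1) := by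
  rw [schensted, h]

/-- The first row of the tableau after insertion, also when the tableau was empty; this is where the
column conditions between two consecutive rows meet. -/
theorem schensted_headD (x : α) (P : List (List α)) :
    (schensted x P).1.headD [] = (rowInsert x (P.headD [])).1 := by
  cases P with
  | nil => rfl
  | cons r rs =>
    rcases h : rowInsert x r with ⟨r', _ | y⟩
    · simp [schensted_cons_of_none h, h]
    · simp [schensted_cons_of_some h, h]

theorem IsTableau.schensted {P : List (List α)} (hP : IsTableau P) (x : α) :
    IsTableau (schensted x P).1 := by
  induction P generalizing x with
  | nil => simp [QuantumEhrhart.schensted, IsTableau]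
  | cons r rs ih =>
    obtain ⟨h1, h2, h3, h4⟩ := hP
    have hs := pairwise_rowInsert x h2
    have hm := mem_rowInsert_self x r
    rcases h : rowInsert x r with ⟨r', _ | y⟩
    · rw [h] at hs hm
      rw [schensted_cons_of_none h]
      refine ⟨List.ne_nil_of_mem hm, hs, ?_, h4⟩
      rw [(rowInsert_eq_none h).1]
      exact h3.append _
    · rw [h] at hs hm
      rw [schensted_cons_of_some h]
      refine ⟨List.ne_nil_of_mem hm, hs, ?_, ih h4 y⟩
      rw [schensted_headD]
      exact h3.rowInsert h2 h

theorem schensted_flatten_perm (x : α) (P : List (List α)) :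
    (schensted x P).1.flatten.Perm (x :: P.flatten) := by
  induction P generalizing x with
  | nil => simp [schensted]
  | cons r rs ih =>
    rcases h : rowInsert x r with ⟨r', _ | y⟩
    · rw [schensted_cons_of_none h, (rowInsert_eq_none h).1]
      simp only [List.flatten_cons, List.append_assoc, List.singleton_append]
      exact List.perm_middle
    · rw [schensted_cons_of_some h]
      simp only [List.flatten_cons]
      refine ((ih y).append_left r').trans (List.perm_middle.trans ?_)
      exact (rowInsert_eq_some h).2.append_right _

/-- An RSK step inserts `x` into the insertion tableau and adds the new cell, with label `k`, to the
recording tableau. The shapes have to agree because a step on an empty insertion tableau discards the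
recording tableau. -/
theorem rskInsert_eq (x : α) (k : ℕ) {P : List (List α)} {Q : List (List ℕ)}
    (h : P.map List.length = Q.map List.length) :
    rskInsert x k P Q = ((schensted x P).1, addCell Q (schensted x P).2 k) := by
  induction P generalizing x Q with
  | nil =>
    obtain rfl : Q = [] := by simpa using h.symm
    rfl
  | cons r rs ih =>
    rcases Q with _ | ⟨q, qs⟩
    · simp at h
    rw [List.map_cons, List.map_cons, List.cons.injEq] at h
    rcases hx : rowInsert x r with ⟨r', _ | y⟩
    · rw [schensted_cons_of_none hx, rskInsert, hx]
      rfl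
    · rw [schensted_cons_of_some hx, rskInsert, hx]
      simp only [List.tail_cons, ih y h.2]
      rfl

theorem schensted_map_length (x : α) (k : ℕ) {P : List (List α)} {Q : List (List ℕ)}
    (h : P.map List.length = Q.map List.length) :
    (schensted x P).1.map List.length =
      (addCell Q (schensted x P).2 k).map List.length := by
  induction P generalizing x Q with
  | nil =>
    obtain rfl : Q = [] := by simpa using h.symm
    rfl
  | cons r rs ih =>
    rcases Q with _ | ⟨q, qs⟩
    · simp at h
    rw [List.map_cons, List.map_cons, List.cons.injEq] at h
    rcases hx : rowInsert x r with ⟨r', _ | y⟩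
    · rw [schensted_cons_of_none hx, (rowInsert_eq_none hx).1]
      simp [addCell, h]
    · rw [schensted_cons_of_some hx]
      simp [addCell, ih y h.2, length_eq_of_rowInsert_eq_some hx, h.1]

theorem schensted_injective {x x' : α} {P P' : List (List α)} (hP : IsTableau P)
    (hP' : IsTableau P') (h : schensted x P = schensted x' P') : x = x' ∧ P = P' := by
  induction P generalizing x x' P' with
  | nil =>
    rcases P' with _ | ⟨r', rs'⟩
    · simpa [schensted] using h
    · rcases hx : rowInsert x' r' with ⟨t, _ | y⟩
      · rw [schensted_cons_of_none hx, (rowInsert_eq_none hx).1] at h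
        simp only [schensted, Prod.mk.injEq, List.cons.injEq] at h
        have h1 := congrArg List.length h.1.1
        have h2 := List.length_pos_iff.2 hP'.1
        simp only [List.length_append, List.length_singleton] at h1
        omega
      · rw [schensted_cons_of_some hx] at h
        simp [schensted] at h
  | cons r rs ih =>
    rcases P' with _ | ⟨r', rs'⟩
    · rcases hx : rowInsert x r with ⟨t, _ | y⟩
      · rw [schensted_cons_of_none hx, (rowInsert_eq_none hx).1] at h
        simp only [schensted, Prod.mk.injEq, List.cons.injEq] at h
        have h1 := congrArg List.length h.1.1
        have h2 := List.length_pos_iff.2 hP.1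
        simp only [List.length_append, List.length_singleton] at h1
        omega
      · rw [schensted_cons_of_some hx] at h
        simp [schensted] at h
    · rcases hx : rowInsert x r with ⟨t, _ | y⟩ <;> rcases hx' : rowInsert x' r' with ⟨t', _ | y'⟩
      · rw [schensted_cons_of_none hx, schensted_cons_of_none hx', (rowInsert_eq_none hx).1,
          (rowInsert_eq_none hx').1] at h
        simp only [Prod.mk.injEq, List.cons.injEq, and_true] at h
        have := List.append_inj' h.1 rfl
        simp_all
      · rw [schensted_cons_of_none hx, schensted_cons_of_some hx'] at h
        simp at h
      · rw [schensted_cons_of_some hx, schensted_cons_of_none hx'] at h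
        simp at h
      · rw [schensted_cons_of_some hx, schensted_cons_of_some hx'] at h
        simp only [Prod.mk.injEq, List.cons.injEq, Nat.add_right_cancel_iff] at h
        obtain ⟨rfl, rfl⟩ := ih hP.2.2.2 hP'.2.2.2 (Prod.ext h.1.2 h.2)
        obtain ⟨rfl, rfl⟩ := rowInsert_injective hP.2.1 hP'.2.1 hx (h.1.1 ▸ hx')
        exact ⟨rfl, rfl⟩

/-- Reverse insertion: a cell at the end of a row can be removed from a tableau if what is left of
the shape is the shape of a tableau `Q`. -/
theorem exists_schensted_eq {i k : ℕ} {P : List (List α)} {Q : List (List ℕ)} (hP : IsTableau P)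
    (hQ : IsTableau Q) (h : P.map List.length = (addCell Q i k).map List.length) :
    ∃ x P', IsTableau P' ∧ schensted x P' = (P, i) ∧
      P'.map List.length = Q.map List.length := by
  induction i generalizing P Q with
  | zero =>
    rcases P with _ | ⟨r, rs⟩
    · simp [addCell] at h
    simp only [addCell, List.map_cons, List.length_append, List.length_singleton,
      List.cons.injEq] at h
    obtain ⟨h1, h2⟩ := h
    obtain ⟨r, x, rfl⟩ : ∃ r' x, r = r' ++ [x] :=
      ⟨r.dropLast, r.getLast hP.1, (List.dropLast_append_getLast _).symm⟩
    obtain ⟨-, hs, ha, ht⟩ := hP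
    rcases Q with _ | ⟨q, qs⟩
    · have hr : r = [] := by simpa using h1
      have hrs : rs = [] := by simpa using h2
      subst hr hrs
      exact ⟨x, [], trivial, rfl, rfl⟩
    · simp only [List.headD_cons, List.length_append, List.length_singleton,
        Nat.add_right_cancel_iff, List.tail_cons] at h1 h2
      have hle : (rs.headD []).length ≤ r.length := by
        have h3 := (above_iff.1 hQ.2.2.1).1
        rcases rs with _ | ⟨s, rs⟩
        · simp
        · rcases qs with _ | ⟨q', qs⟩
          · simp at h2
          · simp only [List.map_cons, List.cons.injEq] at h2
            simp only [List.headD_cons] at h3 ⊢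
            omega
      have hx := rowInsert_eq_append (x := x) (r := r) fun a ha' => by
        rw [List.pairwise_append] at hs
        exact hs.2.2 a ha' x (by simp)
      refine ⟨x, r :: rs, ⟨?_, hs.sublist (List.sublist_append_left _ _), ha.of_append hle, ht⟩,
        schensted_cons_of_none hx, by simp [h1, h2]⟩
      rintro rfl
      exact hQ.1 (List.length_eq_zero_iff.1 h1.symm)
  | succ i ih =>
    rcases P with _ | ⟨r, rs⟩
    · simp [addCell] at h
    simp only [addCell, List.map_cons, List.cons.injEq] at h
    obtain ⟨h1, h2⟩ := h
    obtain ⟨hn, hs, ha, ht⟩ := hP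
    rcases Q with _ | ⟨q, qs⟩
    · exact absurd (List.length_eq_zero_iff.1 h1) hn
    obtain ⟨y, rs', h3, h4, h5⟩ := ih ht hQ.2.2.2 h2
    have h6 : rs.headD [] = (rowInsert y (rs'.headD [])).1 := by
      rw [← schensted_headD, h4]
    rw [h6] at ha
    have h7 : (rs'.headD []).Pairwise (· ≤ ·) := by
      rcases rs' with _ | ⟨s, rs'⟩
      · simp
      · exact h3.2.1
    obtain ⟨x, r', h8, h9, h10⟩ := ha.exists_rowInsert_eq hs h7
    have hl := length_eq_of_rowInsert_eq_some h9
    refine ⟨x, r' :: rs', ⟨?_, h8, h10, h3⟩, ?_, ?_⟩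
    · rintro rfl
      exact hn (List.length_eq_zero_iff.1 hl)
    · rw [schensted_cons_of_some h9, h4]
    · simp_all

theorem addCell_flatten_perm {β : Type} (T : List (List β)) (i : ℕ) (k : β) :
    (addCell T i k).flatten.Perm (k :: T.flatten) := by
  induction i generalizing T with
  | zero =>
    rcases T with _ | ⟨r, rs⟩
    · simp [addCell]
    · simp only [addCell, List.headD_cons, List.tail_cons, List.flatten_cons, List.append_assoc,
        List.singleton_append]
      exact List.perm_middle
  | succ i ih =>
    rcases T with _ | ⟨r, rs⟩
    · simpa [addCell] using ih []
    · simp only [addCell, List.headD_cons, List.tail_cons, List.flatten_cons]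
      exact ((ih rs).append_left r).trans List.perm_middle

theorem addCell_injective {β : Type} {T T' : List (List β)} {i i' : ℕ} {k : β}
    (hT : ∀ r ∈ T, r ≠ []) (hT' : ∀ r ∈ T', r ≠ []) (hk : k ∉ T.flatten) (hk' : k ∉ T'.flatten)
    (h : addCell T i k = addCell T' i' k) : i = i' ∧ T = T' := by
  induction i generalizing T T' i' with
  | zero =>
    cases i' with
    | zero =>
      refine ⟨rfl, ?_⟩
      rcases T with _ | ⟨r, rs⟩ <;> rcases T' with _ | ⟨r', rs'⟩ <;>
        simp_all [addCell]
    | succ i' =>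
      exfalso
      rcases T' with _ | ⟨r', rs'⟩
      · simp [addCell] at h
      · simp only [addCell, List.headD_cons, List.cons.injEq] at h
        apply hk'
        simp [← h.1]
  | succ i ih =>
    cases i' with
    | zero =>
      exfalso
      rcases T with _ | ⟨r', rs'⟩
      · simp [addCell] at h
      · simp only [addCell, List.headD_cons, List.cons.injEq] at h
        apply hk
        simp [h.1]
    | succ i' =>
      simp only [addCell, List.cons.injEq] at h
      obtain ⟨rfl, h2⟩ := ih (T := T.tail) (T' := T'.tail)
        (fun r hr => hT r (List.mem_of_mem_tail hr)) (fun r hr => hT' r (List.mem_of_mem_tail hr))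
        (fun hm => hk (by rcases T with _ | ⟨r, rs⟩ <;> simp_all))
        (fun hm => hk' (by rcases T' with _ | ⟨r, rs⟩ <;> simp_all)) h.2
      refine ⟨rfl, ?_⟩
      rcases T with _ | ⟨r, rs⟩ <;> rcases T' with _ | ⟨r', rs'⟩
      · rfl
      · exact absurd h.1.symm (hT' r' (by simp))
      · exact absurd h.1 (hT r (by simp))
      · exact congrArg₂ List.cons h.1 h2

theorem IsTableau.ne_nil {P : List (List α)} (hP : IsTableau P) : ∀ r ∈ P, r ≠ [] := by
  induction P with
  | nil => simp
  | cons r rs ih => exact List.forall_mem_cons.2 ⟨hP.1, ih hP.2.2.2⟩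

/-- The largest entry of a tableau, if it occurs only once, lies at the end of its row and can be
removed. The first row of what remains is a prefix of the old one, which in the induction keeps the
columns strict between the row above and the rest. -/
theorem IsTableau.exists_addCell_eq {m : α} {Q : List (List α)} (hQ : IsTableau Q)
    (hm : m ∈ Q.flatten) (hle : ∀ a ∈ Q.flatten, a ≤ m) :
    ∃ i Q', IsTableau Q' ∧ Q = addCell Q' i m ∧ ∃ t, Q.headD [] = Q'.headD [] ++ t := by
  induction Q with
  | nil => simp at hm
  | cons r rs ih =>
    obtain ⟨h1, h2, h3, h4⟩ := hQ
    by_cases hrs : m ∈ rs.flatten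
    · obtain ⟨i, Q', h5, h6, t, h7⟩ := ih h4 hrs fun a ha => hle a (by simp [ha])
      refine ⟨i + 1, r :: Q', ⟨h1, h2, ?_, h5⟩, by simp [addCell, ← h6], [], by simp⟩
      rw [h7] at h3
      exact h3.of_append_right
    · have hr : m ∈ r := by simpa [hrs] using hm
      obtain ⟨r, x, rfl⟩ : ∃ r' x, r = r' ++ [x] :=
        ⟨r.dropLast, r.getLast h1, (List.dropLast_append_getLast _).symm⟩
      have hx : m = x := by
        refine le_antisymm ?_ (hle x (by simp))
        rw [List.pairwise_append] at h2
        rcases List.mem_append.1 hr with h | h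
        · exact h2.2.2 m h x (by simp)
        · simp_all
      subst hx
      by_cases hr0 : r = []
      · subst hr0
        rcases rs with _ | ⟨s, rs⟩
        · exact ⟨0, [], trivial, rfl, [m], rfl⟩
        · exfalso
          have hs := h4.1
          rcases s with _ | ⟨b, s⟩
          · exact hs rfl
          · exact absurd h3.1 (not_lt.2 (hle b (by simp)))
      · refine ⟨0, r :: rs, ⟨hr0, h2.sublist (List.sublist_append_left _ _), h3.of_append ?_, h4⟩,
          by simp [addCell], [m], by simp⟩
        rw [above_iff] at h3
        by_contra hlt
        have h5 := h3.1
        simp only [List.length_append, List.length_singleton] at h5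
        have h6 := h3.2 r.length (by simp) (by omega)
        simp only [List.getElem_concat_length] at h6
        refine absurd h6 (not_lt.2 (hle _ ?_))
        rcases rs with _ | ⟨s, rs⟩
        · simp at hlt
        · simp

/-! ### The Robinson–Schensted–Knuth bijection -/

theorem rsk_succ {n : ℕ} (v : Fin (n + 1) → α) :
    rsk v = rskInsert (v (Fin.last n)) (n + 1) (rsk fun i => v i.castSucc).1
      (rsk fun i => v i.castSucc).2 := by
  simp [rsk, List.finRange_succ_last, List.foldl_map]

theorem isTableau_rsk {n : ℕ} (v : Fin n → α) :
    IsTableau (rsk v).1 ∧ (rsk v).1.map List.length = (rsk v).2.map List.length := by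
  induction n with
  | zero => simp [rsk, IsTableau]
  | succ n ih =>
    obtain ⟨h1, h2⟩ := ih fun i => v i.castSucc
    rw [rsk_succ, rskInsert_eq _ _ h2]
    exact ⟨h1.schensted _, schensted_map_length _ _ h2⟩

theorem rsk_succ_eq {n : ℕ} (v : Fin (n + 1) → α) :
    rsk v = ((schensted (v (Fin.last n)) (rsk fun i => v i.castSucc).1).1,
      addCell (rsk fun i => v i.castSucc).2
        (schensted (v (Fin.last n)) (rsk fun i => v i.castSucc).1).2 (n + 1)) := by
  rw [rsk_succ, rskInsert_eq _ _ (isTableau_rsk _).2]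

theorem rsk_snd_flatten_perm {n : ℕ} (v : Fin n → α) :
    (rsk v).2.flatten.Perm (List.range' 1 n) := by
  induction n with
  | zero => simp [rsk]
  | succ n ih =>
    rw [rsk_succ_eq, List.range'_concat, one_mul, Nat.add_comm 1 n]
    exact (addCell_flatten_perm _ _ _).trans
      (((ih _).cons _).trans (List.perm_append_singleton _ _).symm)

theorem rsk_fst_flatten_perm {n : ℕ} (v : Fin n → α) :
    (rsk v).1.flatten.Perm (List.ofFn v) := by
  induction n with
  | zero => simp [rsk]
  | succ n ih =>
    rw [rsk_succ_eq, List.ofFn_succ', List.concat_eq_append]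
    exact (schensted_flatten_perm _ _).trans
      (((ih _).cons _).trans (List.perm_append_singleton _ _).symm)

theorem rsk_snd_ne_nil {n : ℕ} (v : Fin n → α) : ∀ r ∈ (rsk v).2, r ≠ [] := by
  rintro _ hr rfl
  have h : 0 ∈ (rsk v).2.map List.length := List.mem_map.2 ⟨_, hr, rfl⟩
  rw [← (isTableau_rsk v).2] at h
  obtain ⟨r, hr, h0⟩ := List.mem_map.1 h
  exact (isTableau_rsk v).1.ne_nil r hr (List.length_eq_zero_iff.1 h0)

theorem rsk_injective {n : ℕ} {v v' : Fin n → α} (h : rsk v = rsk v') : v = v' := by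
  induction n with
  | zero => exact Subsingleton.elim _ _
  | succ n ih =>
    have hmem (u : Fin n → α) : n + 1 ∉ (rsk u).2.flatten := by
      rw [(rsk_snd_flatten_perm u).mem_iff, List.mem_range'_1]
      omega
    rw [rsk_succ_eq, rsk_succ_eq, Prod.mk.injEq] at h
    obtain ⟨h1, h2⟩ := addCell_injective (rsk_snd_ne_nil _) (rsk_snd_ne_nil _) (hmem _) (hmem _) h.2
    obtain ⟨h3, h4⟩ := schensted_injective (isTableau_rsk _).1 (isTableau_rsk _).1 (Prod.ext h.1 h1)
    have h5 := ih (Prod.ext h4 h2)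
    ext i
    induction i using Fin.lastCases with
    | last => exact h3
    | cast i => exact congrFun h5 i

/-- Every pair of a semistandard tableau `P` and a standard tableau `Q` of the same shape comes
from a word. -/
theorem exists_rsk_eq {n : ℕ} {P : List (List α)} {Q : List (List ℕ)} (hP : IsTableau P)
    (hQ : IsTableau Q) (hn : Q.flatten.Perm (List.range' 1 n))
    (h : P.map List.length = Q.map List.length) : ∃ v : Fin n → α, rsk v = (P, Q) := by
  induction n generalizing P Q with
  | zero =>
    have hQ0 : Q = [] := by
      rcases Q with _ | ⟨q, qs⟩
      · rfl
      · have := hQ.1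
        simp_all
    subst hQ0
    obtain rfl : P = [] := by simpa using h
    exact ⟨Fin.elim0, rfl⟩
  | succ n ih =>
    obtain ⟨i, Q', h1, rfl, -⟩ := hQ.exists_addCell_eq (m := n + 1)
      (by rw [hn.mem_iff, List.mem_range'_1]; omega)
      (fun a ha => by rw [hn.mem_iff, List.mem_range'_1] at ha; omega)
    obtain ⟨x, P', h2, h3, h4⟩ := exists_schensted_eq hP h1 h
    have h5 : Q'.flatten.Perm (List.range' 1 n) := by
      rw [List.range'_concat, one_mul, Nat.add_comm 1 n] at hn
      exact ((addCell_flatten_perm _ _ _).symm.trans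
        (hn.trans (List.perm_append_singleton _ _))).cons_inv
    obtain ⟨v, hv⟩ := ih h2 h1 h5 h4
    refine ⟨Fin.snoc v x, ?_⟩
    rw [rsk_succ_eq]
    simp only [Fin.snoc_last, Fin.snoc_castSucc, hv, h3]

end Insertion

/-! ### Tableaux on a Young diagram and their rows -/

theorem isTableau_iff {α : Type} [LinearOrder α] {P : List (List α)} : IsTableau P ↔
    (∀ r ∈ P, r ≠ [] ∧ r.Pairwise (· ≤ ·)) ∧
      ∀ (i : ℕ) (h : i + 1 < P.length), Above P[i] P[i + 1] := by
  induction P with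
  | nil => simp [IsTableau]
  | cons r rs ih =>
    rw [IsTableau, ih, List.forall_mem_cons]
    constructor
    · rintro ⟨h1, h2, h3, h4, h5⟩
      refine ⟨⟨⟨h1, h2⟩, h4⟩, fun i hi => ?_⟩
      rw [List.length_cons] at hi
      cases i with
      | zero =>
        rcases rs with _ | ⟨s, rs⟩
        · simp at hi
        · exact h3
      | succ i => exact h5 i (by omega)
    · rintro ⟨⟨⟨h1, h2⟩, h4⟩, h5⟩
      refine ⟨h1, h2, ?_, h4, fun i hi => h5 (i + 1) (by simpa using hi)⟩
      rcases rs with _ | ⟨s, rs⟩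
      · exact above_nil _
      · exact h5 0 (by simp)

/-- The list of the rows of a filling `f` of the Young diagram `μ`. -/
def rowsOf {β : Type} (μ : YoungDiagram) (f : ℕ → ℕ → β) : List (List β) :=
  (List.range (μ.colLen 0)).map fun i => (List.range (μ.rowLen i)).map (f i)

/-- The entry in the cell `(i, j)` of a tableau given by its rows, `0` outside the tableau. -/
def entry (P : List (List ℕ)) (i j : ℕ) : ℕ := (P.getD i []).getD j 0

theorem pos_rowLen_iff {μ : YoungDiagram} {i : ℕ} : 0 < μ.rowLen i ↔ i < μ.colLen 0 := by
  rw [← YoungDiagram.mem_iff_lt_rowLen, YoungDiagram.mem_iff_lt_colLen]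

theorem entry_rowsOf (μ : YoungDiagram) (f : ℕ → ℕ → ℕ) (i j : ℕ) :
    entry (rowsOf μ f) i j = if (i, j) ∈ μ then f i j else 0 := by
  unfold entry rowsOf
  by_cases hi : i < μ.colLen 0
  · by_cases hj : j < μ.rowLen i
    · rw [if_pos (YoungDiagram.mem_iff_lt_rowLen.2 hj)]
      simp [List.getD_eq_getElem?_getD, hi, hj]
    · rw [if_neg (fun h => hj (YoungDiagram.mem_iff_lt_rowLen.1 h))]
      simp [List.getD_eq_getElem?_getD, hi, hj]
  · have h0 : ¬ 0 < μ.rowLen i := fun h => hi (pos_rowLen_iff.1 h)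
    rw [if_neg (fun h => h0 ((Nat.zero_le j).trans_lt (YoungDiagram.mem_iff_lt_rowLen.1 h)))]
    simp [List.getD_eq_getElem?_getD, hi]

theorem isTableau_rowsOf {μ : YoungDiagram} (T : SemistandardYoungTableau μ) :
    IsTableau (rowsOf μ T) := by
  rw [isTableau_iff]
  refine ⟨fun r hr => ?_, fun i hi => ?_⟩
  · obtain ⟨i, hi, rfl⟩ := List.mem_map.1 hr
    rw [List.mem_range] at hi
    refine ⟨?_, ?_⟩
    · rw [← List.length_pos_iff]
      simpa using pos_rowLen_iff.2 hi
    · rw [List.pairwise_map, List.pairwise_iff_getElem]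
      intro a b ha hb hab
      simp only [List.length_range] at ha hb
      simpa using T.row_weak hab (YoungDiagram.mem_iff_lt_rowLen.2 hb)
  · rw [above_iff]
    refine ⟨by simpa [rowsOf] using μ.rowLen_anti _ _ (Nat.le_succ i), fun j h1 h2 => ?_⟩
    simp only [rowsOf, List.getElem_map, List.getElem_range, List.length_map,
      List.length_range] at h2 ⊢
    exact T.col_strict (Nat.lt_succ_self i) (YoungDiagram.mem_iff_lt_rowLen.2 h2)

theorem rowsOf_entry {μ : YoungDiagram} {f : ℕ → ℕ → ℕ} {P : List (List ℕ)}
    (h : P.map List.length = (rowsOf μ f).map List.length) : rowsOf μ (entry P) = P := by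
  have hlen : P.length = μ.colLen 0 := by simpa [rowsOf] using congrArg List.length h
  have hrow (i : ℕ) (hi : i < P.length) : P[i].length = μ.rowLen i := by
    have h1 : (P.map List.length)[i]'(by simpa) = ((rowsOf μ f).map List.length)[i]'(by
      rw [← h]; simpa) := by simp [h]
    simpa [rowsOf] using h1
  refine List.ext_getElem (by simp [rowsOf, hlen]) fun i h1 h2 => ?_
  refine List.ext_getElem (by simp [rowsOf, hrow]) fun j h3 h4 => ?_
  simp [rowsOf, entry, List.getD_eq_getElem?_getD, h2, h4]

/-- The semistandard tableau on `μ` with given rows. -/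
theorem IsTableau.exists_ssyt {μ : YoungDiagram} {f : ℕ → ℕ → ℕ} {P : List (List ℕ)}
    (hP : IsTableau P) (h : P.map List.length = (rowsOf μ f).map List.length) :
    ∃ T : SemistandardYoungTableau μ, rowsOf μ T = P := by
  have hr := rowsOf_entry h
  rw [← hr, isTableau_iff] at hP
  obtain ⟨h1, h2⟩ := hP
  have hcol (i j : ℕ) (hij : (i + 1, j) ∈ μ) : entry P i j < entry P (i + 1) j := by
    have hc : i + 1 < μ.colLen 0 := by
      rw [← pos_rowLen_iff]
      exact (Nat.zero_le j).trans_lt (YoungDiagram.mem_iff_lt_rowLen.1 hij)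
    have h3 := (above_iff.1 (h2 i (by simpa [rowsOf] using hc))).2 j
      (by simpa [rowsOf] using
        YoungDiagram.mem_iff_lt_rowLen.1 (μ.up_left_mem (Nat.le_succ i) le_rfl hij))
      (by simpa [rowsOf] using YoungDiagram.mem_iff_lt_rowLen.1 hij)
    simpa [rowsOf] using h3
  refine ⟨⟨entry P, fun {i j1 j2} hj hc => ?_, fun {i1 i2 j} hi hc => ?_, fun {i j} hc => ?_⟩, hr⟩
  · have hc' := YoungDiagram.mem_iff_lt_rowLen.1 hc
    have h3 := (h1 ((List.range (μ.rowLen i)).map (entry P i)) (List.mem_map.2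
      ⟨i, List.mem_range.2 (pos_rowLen_iff.1 (by omega)), rfl⟩)).2
    rw [List.pairwise_iff_getElem] at h3
    have h4 := h3 j1 j2 (by simp; omega) (by simpa using hc') hj
    rwa [List.getElem_map, List.getElem_map, List.getElem_range, List.getElem_range] at h4
  · induction i2, hi using Nat.le_induction with
    | base => exact hcol _ _ hc
    | succ i2 hi ih =>
      exact (ih (μ.up_left_mem (Nat.le_succ i2) le_rfl hc)).trans (hcol _ _ hc)
  · rw [← hr, entry_rowsOf, if_neg hc]

theorem rowsOf_flatten_perm {β : Type} (μ : YoungDiagram) (f : ℕ → ℕ → β) :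
    (rowsOf μ f).flatten.Perm (μ.cells.toList.map fun c => f c.1 c.2) := by
  have h1 : rowsOf μ f = (rowsOf μ Prod.mk).map (List.map fun c => f c.1 c.2) := by
    simp [rowsOf, Function.comp_def]
  rw [h1, ← List.map_flatten]
  refine List.Perm.map _ ((List.perm_ext_iff_of_nodup ?_ (Finset.nodup_toList _)).2 ?_)
  · rw [List.nodup_flatten]
    refine ⟨fun l hl => ?_, ?_⟩
    · obtain ⟨i, -, rfl⟩ := List.mem_map.1 hl
      exact List.nodup_range.map fun a b h => (Prod.mk.inj h).2
    · rw [rowsOf, List.pairwise_map]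
      refine List.nodup_range.imp fun {a b} hab => ?_
      intro c hc hc'
      obtain ⟨j, -, rfl⟩ := List.mem_map.1 hc
      obtain ⟨j', -, h⟩ := List.mem_map.1 hc'
      exact hab (Prod.mk.inj h).1.symm
  · rintro ⟨i, j⟩
    simp only [rowsOf, List.mem_flatten, List.mem_map, List.mem_range, Finset.mem_toList,
      YoungDiagram.mem_cells]
    constructor
    · rintro ⟨_, ⟨i', hi, rfl⟩, h⟩
      obtain ⟨j', hj, h⟩ := List.mem_map.1 h
      obtain ⟨rfl, rfl⟩ := Prod.mk.inj h
      exact YoungDiagram.mem_iff_lt_rowLen.2 (List.mem_range.1 hj)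
    · intro h
      have hj := YoungDiagram.mem_iff_lt_rowLen.1 h
      exact ⟨_, ⟨i, pos_rowLen_iff.1 (by omega), rfl⟩, List.mem_map.2 ⟨j, List.mem_range.2 hj, rfl⟩⟩

theorem SYT.rowsOf_flatten_perm {μ : YoungDiagram} (Q : SYT μ) :
    (rowsOf μ Q.1).flatten.Perm (List.range' 1 μ.card) := by
  refine (QuantumEhrhart.rowsOf_flatten_perm μ Q.1).trans
    ((List.perm_ext_iff_of_nodup ?_ List.nodup_range').2 ?_)
  · refine (Finset.nodup_toList _).map_on fun c hc d hd h => ?_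
    rw [Finset.mem_toList] at hc hd
    exact Q.2.injOn hc hd h
  · intro a
    have := Set.ext_iff.1 Q.2.image_eq a
    simp only [Set.mem_image, Set.mem_Icc, Finset.mem_coe] at this
    simp only [List.mem_map, Finset.mem_toList, this, List.mem_range'_1]
    omega

theorem rowsOf_injective {μ : YoungDiagram} {T T' : SemistandardYoungTableau μ}
    (h : rowsOf μ T = rowsOf μ T') : T = T' := by
  ext i j
  have h1 := entry_rowsOf μ T i j
  rw [h, entry_rowsOf] at h1
  by_cases hc : (i, j) ∈ μ
  · simpa [hc] using h1.symm
  · rw [T.zeros hc, T'.zeros hc]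

theorem eq_of_getD_eq {r r' : List ℕ} (hr : 0 ∉ r) (hr' : 0 ∉ r')
    (h : ∀ j, r.getD j 0 = r'.getD j 0) : r = r' := by
  induction r generalizing r' with
  | nil =>
    cases r' with
    | nil => rfl
    | cons a r' => exact absurd (h 0) (by simp at hr' ⊢; omega)
  | cons a r ih =>
    cases r' with
    | nil => exact absurd (h 0) (by simp at hr ⊢; omega)
    | cons a' r' =>
      rw [List.mem_cons, not_or] at hr hr'
      rw [show a = a' from h 0, ih hr.2 hr'.2 fun j => h (j + 1)]

/-- A filling by nonzero entries of a diagram without empty rows is determined by its entries,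
continued by `0` outside of the diagram. -/
theorem eq_of_entry_eq {P P' : List (List ℕ)} (hP : ∀ r ∈ P, r ≠ []) (hP' : ∀ r ∈ P', r ≠ [])
    (h0 : 0 ∉ P.flatten) (h0' : 0 ∉ P'.flatten) (h : ∀ i j, entry P i j = entry P' i j) :
    P = P' := by
  induction P generalizing P' with
  | nil =>
    rcases P' with _ | ⟨_ | ⟨a, r⟩, rs⟩
    · rfl
    · exact absurd rfl (hP' [] (by simp))
    · exact absurd (h 0 0) (by simp [entry] at h0' ⊢; omega)
  | cons r rs ih =>
    rcases P' with _ | ⟨r', rs'⟩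
    · rcases r with _ | ⟨a, r⟩
      · exact absurd rfl (hP [] (by simp))
      · exact absurd (h 0 0) (by simp [entry] at h0 ⊢; omega)
    · rw [List.forall_mem_cons] at hP hP'
      rw [List.flatten_cons, List.mem_append, not_or] at h0 h0'
      rw [eq_of_getD_eq h0.1 h0'.1 fun j => h 0 j,
        ih hP.2 hP'.2 h0.2 h0'.2 fun i j => h (i + 1) j]

theorem forall_recordingEntry_eq_iff {α : Type} [LinearOrder α] {μ : YoungDiagram} (Q : SYT μ)
    (v : Fin μ.card → α) :
    (∀ i j, recordingEntry v i j = Q.1 i j) ↔ (rsk v).2 = rowsOf μ Q.1 := by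
  have hQ (i j : ℕ) : entry (rowsOf μ Q.1) i j = Q.1 i j := by
    rw [entry_rowsOf]
    split_ifs with hc
    · rfl
    · rw [Q.1.zeros hc]
  constructor
  · intro h
    refine eq_of_entry_eq (rsk_snd_ne_nil v) (isTableau_rowsOf Q.1).ne_nil ?_ ?_
      fun i j => (h i j).trans (hQ i j).symm
    · rw [(rsk_snd_flatten_perm v).mem_iff, List.mem_range'_1]
      omega
    · rw [Q.rowsOf_flatten_perm.mem_iff, List.mem_range'_1]
      omega
  · intro h i j
    rw [← hQ, ← h]
    rfl

/-! ### Lattice points of the chambers -/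

-- Insertion only compares letters, so it commutes with strictly increasing maps.
section StrictMono

variable {α β : Type} [LinearOrder α] [LinearOrder β] {f : α → β}

theorem rowInsert_map (hf : StrictMono f) (x : α) (r : List α) :
    rowInsert (f x) (r.map f) = ((rowInsert x r).1.map f, (rowInsert x r).2.map f) := by
  induction r with
  | nil => rfl
  | cons a r ih =>
    rw [List.map_cons, rowInsert, rowInsert]
    simp only [hf.lt_iff_lt, ih]
    split_ifs <;> rfl

theorem schensted_map (hf : StrictMono f) (x : α) (P : List (List α)) :
    schensted (f x) (P.map (List.map f)) =
      ((schensted x P).1.map (List.map f), (schensted x P).2) := by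
  induction P generalizing x with
  | nil => rfl
  | cons r rs ih =>
    rcases h : rowInsert x r with ⟨r', _ | y⟩
    · rw [List.map_cons, schensted_cons_of_none h,
        schensted_cons_of_none (r' := r'.map f) (by rw [rowInsert_map hf, h]; rfl)]
      rfl
    · rw [List.map_cons, schensted_cons_of_some h,
        schensted_cons_of_some (r' := r'.map f) (y := f y) (by rw [rowInsert_map hf, h]; rfl), ih]
      rfl

theorem rsk_comp (hf : StrictMono f) {n : ℕ} (v : Fin n → α) :
    rsk (fun i => f (v i)) = ((rsk v).1.map (List.map f), (rsk v).2) := by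
  induction n with
  | zero => rfl
  | succ n ih =>
    rw [rsk_succ_eq, rsk_succ_eq v, ih fun i => v i.castSucc, schensted_map hf]

theorem recordingEntry_comp (hf : StrictMono f) {n : ℕ} (v : Fin n → α) :
    recordingEntry (fun i => f (v i)) = recordingEntry v := by
  unfold recordingEntry
  rw [rsk_comp hf]

end StrictMono

theorem mem_dilate_coarseChamber {μ : YoungDiagram} (Q : SYT μ) (h : ℕ) (p : Fin μ.card → ℝ) :
    p ∈ dilate h (coarseChamber Q) ↔
      (∀ i, 0 ≤ p i ∧ p i ≤ h) ∧ ∀ i j, recordingEntry p i j = Q.1 i j := by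
  unfold dilate
  split_ifs with h0
  · subst h0
    constructor
    · rintro ⟨hp, rfl⟩
      exact ⟨fun i => by simp, hp.2⟩
    · rintro ⟨h1, h2⟩
      have hp : p = 0 := by
        ext i
        exact le_antisymm (by simpa using (h1 i).2) (h1 i).1
      subst hp
      exact ⟨⟨fun i => by simp, h2⟩, rfl⟩
  · have hpos : (0 : ℝ) < h := by exact_mod_cast Nat.pos_of_ne_zero h0
    have hmono : StrictMono fun x : ℝ => (h : ℝ) * x :=
      fun a b hab => mul_lt_mul_of_pos_left hab hpos
    constructor
    · rintro ⟨p, ⟨h1, h2⟩, rfl⟩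
      refine ⟨fun i => ?_, fun i j => ?_⟩
      · simp only [Pi.smul_apply, smul_eq_mul]
        exact ⟨mul_nonneg hpos.le (h1 i).1, mul_le_of_le_one_right hpos.le (h1 i).2⟩
      · exact (congrFun₂ (recordingEntry_comp hmono p) i j).trans (h2 i j)
    · rintro ⟨h1, h2⟩
      have hp : p = (h : ℝ) • fun i => p i / h := by
        ext i
        simp only [Pi.smul_apply, smul_eq_mul]
        field_simp
      refine ⟨fun i => p i / h, ⟨fun i => ⟨div_nonneg (h1 i).1 hpos.le, ?_⟩, fun i j => ?_⟩, hp.symm⟩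
      · exact (div_le_one hpos).2 (h1 i).2
      · rw [← h2, ← recordingEntry_comp hmono]
        exact congrArg (fun p : Fin μ.card → ℝ => recordingEntry p i j) hp.symm

/-- Translated by `h / 2`, the lattice points of the dilated chamber are the words over
`{0, …, h}` with recording tableau `Q`. -/
theorem centeredDilate_inter_eq {μ : YoungDiagram} (Q : SYT μ) (h : ℕ) :
    centeredDilate h (coarseChamber Q) ∩ shiftedLattice μ.card h =
      (fun (v : Fin μ.card → ℕ) i => (v i : ℝ) - (h : ℝ) / 2) ''
        {v | (∀ i, v i ≤ h) ∧ (rsk v).2 = rowsOf μ Q.1} := by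
  have hmono : StrictMono (Nat.cast : ℕ → ℝ) := Nat.strictMono_cast
  ext x
  constructor
  · rintro ⟨⟨p, hp, rfl⟩, hx⟩
    rw [mem_dilate_coarseChamber] at hp
    have hv (i : Fin μ.card) : ∃ n : ℕ, p i = n := by
      obtain ⟨m, hm⟩ := hx i
      have h1 : p i = ((h + m : ℤ) : ℝ) := by
        push_cast
        linarith
      have h2 : 0 ≤ (h + m : ℤ) := by
        have := (hp.1 i).1
        rw [h1] at this
        exact_mod_cast this
      obtain ⟨n, hn⟩ := Int.eq_ofNat_of_zero_le h2
      exact ⟨n, by rw [h1, hn]; simp⟩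
    choose v hv using hv
    obtain rfl : p = fun i => (v i : ℝ) := funext hv
    refine ⟨v, ⟨fun i => Nat.cast_le.1 (hp.1 i).2, ?_⟩, rfl⟩
    rw [← forall_recordingEntry_eq_iff, ← recordingEntry_comp hmono]
    exact hp.2
  · rintro ⟨v, ⟨h1, h2⟩, rfl⟩
    refine ⟨⟨fun i => (v i : ℝ), ?_, rfl⟩, fun i => ⟨(v i : ℤ) - h, ?_⟩⟩
    · rw [mem_dilate_coarseChamber]
      refine ⟨fun i => ⟨Nat.cast_nonneg _, by exact_mod_cast h1 i⟩, ?_⟩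
      rw [recordingEntry_comp hmono]
      exact (forall_recordingEntry_eq_iff Q v).2 h2
    · push_cast
      ring

/-- The principal specialization of the Schur polynomial `s_μ` at `q⁻ʰ, q²⁻ʰ, …, qʰ`. -/
noncomputable def principalSchur (μ : YoungDiagram) (h : ℕ) : LaurentPolynomial ℤ :=
  ∑ T : SSYTBelow (h + 1) μ, qPow (2 * ∑ c ∈ μ.cells, (T.1 c.1 c.2 : ℤ) - h * μ.card)

theorem quantumEhrhart_coarseChamber {μ : YoungDiagram} (Q : SYT μ) (h : ℕ) :
    quantumEhrhart (coarseChamber Q) h = principalSchur μ h := by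
  have hex (T : SSYTBelow (h + 1) μ) :
      ∃ v : Fin μ.card → ℕ, rsk v = (rowsOf μ T.1, rowsOf μ Q.1) :=
    exists_rsk_eq (isTableau_rowsOf T.1) (isTableau_rowsOf Q.1) Q.rowsOf_flatten_perm
      (by simp [rowsOf])
  choose word hword using hex
  have hinj : Function.Injective word := fun T T' hT => by
    have h1 := hword T
    rw [hT, hword T'] at h1
    exact Subtype.ext (rowsOf_injective (Prod.mk.inj h1).1.symm)
  have hrange : {v : Fin μ.card → ℕ | (∀ i, v i ≤ h) ∧ (rsk v).2 = rowsOf μ Q.1} =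
      Set.range word := by
    ext v
    constructor
    · rintro ⟨h1, h2⟩
      obtain ⟨T, hT⟩ := (isTableau_rsk v).1.exists_ssyt (h2 ▸ (isTableau_rsk v).2)
      refine ⟨⟨T, fun c hc => ?_⟩, rsk_injective ((hword _).trans (Prod.ext hT h2.symm))⟩
      have h3 : T c.1 c.2 ∈ List.ofFn v := by
        rw [← (rsk_fst_flatten_perm v).mem_iff, ← hT, (rowsOf_flatten_perm μ T).mem_iff]
        exact List.mem_map.2 ⟨c, Finset.mem_toList.2 hc, rfl⟩
      obtain ⟨i, hi⟩ := (List.mem_ofFn' v _).1 h3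
      have := h1 i
      omega
    · rintro ⟨T, rfl⟩
      refine ⟨fun i => ?_, by rw [hword]⟩
      have h3 : word T i ∈ (rowsOf μ T.1).flatten := by
        have h4 := (rsk_fst_flatten_perm (word T)).mem_iff (a := word T i)
        rw [hword] at h4
        exact h4.2 ((List.mem_ofFn' _ _).2 ⟨i, rfl⟩)
      rw [(rowsOf_flatten_perm μ T.1).mem_iff] at h3
      obtain ⟨c, hc, h5⟩ := List.mem_map.1 h3
      have := T.2 c (Finset.mem_toList.1 hc)
      omega
  have hsum (T : SSYTBelow (h + 1) μ) : ∑ i, word T i = ∑ c ∈ μ.cells, T.1 c.1 c.2 := by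
    have h1 := (rsk_fst_flatten_perm (word T)).sum_eq
    rw [hword, List.sum_ofFn] at h1
    rw [← h1, (rowsOf_flatten_perm μ T.1).sum_eq, Finset.sum_map_toList]
  unfold quantumEhrhart principalSchur
  rw [centeredDilate_inter_eq, finsum_mem_image, hrange, finsum_mem_range hinj,
    finsum_eq_sum_of_fintype]
  · refine Finset.sum_congr rfl fun T _ => congrArg qPow ?_
    rw [Int.floor_eq_iff]
    have h1 : ∑ i, ((word T i : ℝ) - (h : ℝ) / 2) =
        ((∑ c ∈ μ.cells, (T.1 c.1 c.2 : ℤ) : ℤ) : ℝ) - μ.card * (h / 2) := by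
      rw [Finset.sum_sub_distrib]
      have := congrArg (Nat.cast : ℕ → ℝ) (hsum T)
      push_cast at this ⊢
      rw [this]
      simp
    rw [h1]
    push_cast
    constructor <;> linarith
  · intro v _ v' _ hv
    ext i
    simpa using congrFun hv i

/-! ### The plethysm as a principal specialization -/

theorem qPow_add (m n : ℤ) : qPow (m + n) = qPow m * qPow n := LaurentPolynomial.T_add m n

@[simp] theorem qPow_zero : qPow 0 = 1 := LaurentPolynomial.T_zero

theorem qPow_pow (m : ℤ) (n : ℕ) : qPow m ^ n = qPow (n * m) := LaurentPolynomial.T_pow m n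

theorem prod_qPow {ι : Type*} (s : Finset ι) (f : ι → ℤ) :
    ∏ i ∈ s, qPow (f i) = qPow (∑ i ∈ s, f i) := by
  classical
  induction s using Finset.induction_on with
  | empty => simp
  | insert a s ha ih => rw [Finset.prod_insert ha, Finset.sum_insert ha, qPow_add, ih]

theorem mem_oneRow {h : ℕ} {c : ℕ × ℕ} : c ∈ oneRow h ↔ c.1 = 0 ∧ c.2 < h := by
  rw [← YoungDiagram.mem_cells, show (oneRow h).cells = {0} ×ˢ Finset.range h from rfl,
    Finset.mem_product, Finset.mem_singleton, Finset.mem_range]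

/-- The tableau `0 ⋯ 0 1 ⋯ 1` of one row of length `h` in which `1` occurs `k` times. -/
def oneRowTableau (h k : ℕ) : SSYTBelow 2 (oneRow h) :=
  ⟨{ entry := fun i j => if i = 0 ∧ j < h ∧ h - k ≤ j then 1 else 0
     row_weak' := by
      intro i j1 j2 hj hc
      have := mem_oneRow.1 hc
      simp only at this
      split_ifs <;> omega
     col_strict' := by
      intro i1 i2 j hi hc
      have := mem_oneRow.1 hc
      simp only at this
      omega
     zeros' := by
      intro i j hc
      rw [mem_oneRow] at hc
      exact if_neg fun hh => hc ⟨hh.1, hh.2.1⟩ }, by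
    intro c _
    change (if _ then 1 else 0) < 2
    split_ifs <;> omega⟩

theorem oneRowTableau_apply (h k i j : ℕ) :
    (oneRowTableau h k).1 i j = if i = 0 ∧ j < h ∧ h - k ≤ j then 1 else 0 := rfl

/-- The exponent of the monomial `x₀ʰ⁻ᵏ x₁ᵏ`. -/
noncomputable def binaryExponent (h k : ℕ) : Fin 2 →₀ ℕ :=
  Finsupp.single 0 (h - k) + Finsupp.single 1 k

theorem schurPoly_oneRow (h : ℕ) :
    schurPoly 2 (oneRow h) =
      ∑ k ∈ Finset.range (h + 1), MvPolynomial.monomial (binaryExponent h k) 1 := by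
  unfold schurPoly
  symm
  refine Finset.sum_bij (fun k _ => oneRowTableau h k) (fun _ _ => Finset.mem_univ _) ?_ ?_ ?_
  · intro k hk k' hk' heq
    rw [Finset.mem_range] at hk hk'
    have h1 (j : ℕ) := congrArg (fun T : SSYTBelow 2 (oneRow h) => T.1 0 j) heq
    simp only [oneRowTableau_apply, true_and] at h1
    by_contra hne
    rcases Nat.lt_or_gt_of_ne hne with hlt | hlt
    · have := h1 (h - k')
      rw [if_neg (by omega), if_pos (by omega)] at this
      omega
    · have := h1 (h - k)
      rw [if_pos (by omega), if_neg (by omega)] at this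
      omega
  · intro T _
    have hex : ∃ m, h ≤ m ∨ T.1 0 m ≠ 0 := ⟨h, Or.inl le_rfl⟩
    classical
    -- the position of the first entry `1`
    set m := Nat.find hex with hm
    have hmh : m ≤ h := Nat.find_min' hex (Or.inl le_rfl)
    refine ⟨h - m, by simp, ?_⟩
    apply Subtype.ext
    ext i j
    rw [oneRowTableau_apply]
    by_cases hc : (i, j) ∈ oneRow h
    · obtain ⟨hi, hj⟩ := mem_oneRow.1 hc
      simp only at hi hj
      subst hi
      have hlt := T.2 (0, j) ((YoungDiagram.mem_cells _).2 hc)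
      simp only at hlt
      by_cases hjm : j < m
      · have := Nat.find_min hex hjm
        rw [if_neg (by omega)]
        omega
      · have h1 := Nat.find_spec hex
        rw [← hm] at h1
        have h2 := T.1.row_weak_of_le (not_lt.1 hjm) hc
        rw [if_pos (by omega)]
        omega
    · rw [T.1.zeros hc, if_neg]
      rintro ⟨hi, hj, -⟩
      exact hc (mem_oneRow.2 ⟨hi, hj⟩)
  · intro k hk
    rw [Finset.mem_range] at hk
    have h1 : ∀ c : (oneRow h).cells,
        (MvPolynomial.X ⟨(oneRowTableau h k).1 c.1.1 c.1.2, (oneRowTableau h k).2 c.1 c.2⟩ :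
          MvPolynomial (Fin 2) ℕ) =
        (fun c : ℕ × ℕ => if h - k ≤ c.2 then MvPolynomial.X 1 else MvPolynomial.X 0) c.1 := by
      intro c
      have hc := mem_oneRow.1 ((YoungDiagram.mem_cells _).1 c.2)
      have h2 := oneRowTableau_apply h k c.1.1 c.1.2
      simp only [hc.1, hc.2, true_and] at h2
      dsimp only
      split_ifs with hk
      · congr 1
        apply Fin.ext
        simp [hc.1, h2, hk]
      · congr 1
        apply Fin.ext
        simp [hc.1, h2, hk]
    rw [Finset.prod_congr rfl fun c _ => h1 c, Finset.prod_coe_sort (oneRow h).cells fun c : ℕ × ℕ =>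
      if h - k ≤ c.2 then MvPolynomial.X 1 else (MvPolynomial.X 0 : MvPolynomial (Fin 2) ℕ)]
    have h3 : (oneRow h).cells = {0} ×ˢ Finset.range h := rfl
    rw [h3, Finset.prod_product, Finset.prod_singleton]
    rw [Finset.range_eq_Ico, ← Finset.prod_Ico_consecutive _ (Nat.zero_le (h - k)) (Nat.sub_le h k),
      Finset.prod_congr rfl fun j hj => if_neg (by rw [Finset.mem_Ico] at hj; omega),
      Finset.prod_congr rfl fun j (hj : j ∈ Finset.Ico (h - k) h) =>
        if_pos (by rw [Finset.mem_Ico] at hj; omega)]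
    rw [Finset.prod_const, Finset.prod_const, Nat.card_Ico, Nat.card_Ico,
      show h - (h - k) = k by omega, binaryExponent, Nat.sub_zero]
    simp [MvPolynomial.X_pow_eq_monomial, MvPolynomial.monomial_mul]

theorem monomialList_schurPoly_oneRow (h : ℕ) :
    monomialList (schurPoly 2 (oneRow h)) = (List.range (h + 1)).map (binaryExponent h) := by
  have hinj : Function.Injective (binaryExponent h) := fun k k' hk => by
    simpa [binaryExponent] using DFunLike.congr_fun hk 1
  have hcoeff (d : Fin 2 →₀ ℕ) : (schurPoly 2 (oneRow h)).coeff d =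
      if d ∈ (Finset.range (h + 1)).image (binaryExponent h) then 1 else 0 := by
    rw [schurPoly_oneRow, MvPolynomial.coeff_sum]
    simp only [MvPolynomial.coeff_monomial]
    split_ifs with hd
    · obtain ⟨k, hk, rfl⟩ := Finset.mem_image.1 hd
      simp only [hinj.eq_iff]
      rw [Finset.sum_ite_eq', if_pos hk]
    · refine Finset.sum_eq_zero fun k hk => if_neg ?_
      rintro rfl
      exact hd (Finset.mem_image_of_mem _ hk)
  have hsort : ((schurPoly 2 (oneRow h)).support.map toLex.toEmbedding).sort (· ≥ ·) =
      (List.range (h + 1)).map fun k => toLex (binaryExponent h k) := by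
    have hpair : ((List.range (h + 1)).map fun k => toLex (binaryExponent h k)).Pairwise
        (· > ·) := by
      rw [List.pairwise_map]
      refine (List.pairwise_lt_range (n := h + 1)).imp_of_mem fun {k k'} hk hk' hlt => ?_
      rw [List.mem_range] at hk hk'
      refine Finsupp.Lex.lt_iff.2 ⟨0, fun j hj => absurd hj (Fin.not_lt_zero j), ?_⟩
      simp [binaryExponent]
      omega
    refine (List.Perm.eq_of_pairwise' (r := (· ≥ ·)) (Finset.pairwise_sort _ _)
      (hpair.imp fun hlt => le_of_lt hlt) ?_)
    refine (List.perm_ext_iff_of_nodup (Finset.sort_nodup _ _)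
      (hpair.imp fun hlt => ne_of_gt hlt)).2 fun d => ?_
    simp only [Finset.mem_sort, Finset.mem_map, MvPolynomial.mem_support_iff, hcoeff]
    simp
  unfold monomialList
  rw [hsort, List.flatMap_map]
  have hone (k : ℕ) (hk : k ∈ List.range (h + 1)) :
      List.replicate ((schurPoly 2 (oneRow h)).coeff (binaryExponent h k)) (binaryExponent h k) =
        [binaryExponent h k] := by
    rw [hcoeff, if_pos (Finset.mem_image_of_mem _ (by simpa using hk))]
    rfl
  simp only [ofLex_toLex]
  rw [List.flatMap_congr hone, ← List.map_eq_flatMap]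

theorem aeval_schurPoly (μ : YoungDiagram) (h n : ℕ) (hn : n = h + 1)
    (f : Fin n → LaurentPolynomial ℤ) (hf : ∀ i, f i = qPow (2 * (i : ℕ) - h)) :
    MvPolynomial.aeval f (schurPoly n μ) = principalSchur μ h := by
  subst hn
  unfold schurPoly principalSchur
  rw [map_sum]
  refine Finset.sum_congr rfl fun T _ => ?_
  simp only [map_prod, MvPolynomial.aeval_X, hf]
  rw [Finset.prod_coe_sort μ.cells fun c => qPow (2 * (T.1 c.1 c.2 : ℕ) - h), prod_qPow,
    Finset.sum_sub_distrib, ← Finset.mul_sum, Finset.sum_const, nsmul_eq_mul, mul_comm (h : ℤ)]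

theorem sl2Plethysm_eq (μ : YoungDiagram) (h : ℕ) : sl2Plethysm μ h = principalSchur μ h := by
  have hl := monomialList_schurPoly_oneRow h
  unfold sl2Plethysm plethysm
  rw [MvPolynomial.comp_aeval_apply]
  refine aeval_schurPoly μ h _ (by simp [hl]) _ fun i => ?_
  have hi : (i : ℕ) < h + 1 := by simpa [hl] using i.2
  have hget : (monomialList (schurPoly 2 (oneRow h))).get i = binaryExponent h i := by
    simp [hl]
  rw [hget, MvPolynomial.aeval_monomial, binaryExponent, Finsupp.prod_add_index']
  · simp only [map_one, one_mul, Finsupp.prod_single_index, pow_zero, Matrix.cons_val_zero,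
      Matrix.cons_val_one, qPow_pow, ← qPow_add]
    congr 1
    push_cast [Nat.lt_succ_iff.1 hi]
    ring
  · simp
  · intro a b c
    exact pow_add _ _ _

/-! ### Standardization -/

open scoped Classical in
/-- The weakly increasing sequences `a₁ ≤ ⋯ ≤ a_w ≤ h` of natural numbers with `a_i < a_{i+1}` for
all `i ∈ D`. The index set `Fin w` is shifted by one: `a_i` is `a ⟨i - 1, _⟩`. -/
noncomputable def compatible (D : Finset ℕ) (w h : ℕ) : Finset (Fin w → ℕ) :=
  (Fintype.piFinset fun _ => Finset.range (h + 1)).filter fun a =>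
    ∀ (i : ℕ) (hi : i + 1 < w),
      a ⟨i, by omega⟩ + (if i + 1 ∈ D then 1 else 0) ≤ a ⟨i + 1, hi⟩

theorem mem_compatible {D : Finset ℕ} {w h : ℕ} {a : Fin w → ℕ} :
    a ∈ compatible D w h ↔ (∀ i, a i ≤ h) ∧ ∀ (i : ℕ) (hi : i + 1 < w),
      a ⟨i, by omega⟩ + (if i + 1 ∈ D then 1 else 0) ≤ a ⟨i + 1, hi⟩ := by
  simp [compatible]

/-- A sequence indexed by `1, …, w`, as a function on the natural numbers. -/
def shift {w : ℕ} (a : Fin w → ℕ) (k : ℕ) : ℕ := if hk : k - 1 < w then a ⟨k - 1, hk⟩ else 0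

theorem shift_succ {w : ℕ} (a : Fin w → ℕ) (i : Fin w) : shift a (i + 1) = a i := by
  simp [shift]

theorem shift_add_le {D : Finset ℕ} {w h : ℕ} {a : Fin w → ℕ} (ha : a ∈ compatible D w h) {k : ℕ}
    (hk : 1 ≤ k) (hkw : k < w) : shift a k + (if k ∈ D then 1 else 0) ≤ shift a (k + 1) := by
  obtain ⟨k, rfl⟩ := Nat.exists_eq_add_of_le' hk
  rw [shift, shift, dif_pos (by omega), dif_pos (by omega)]
  exact (mem_compatible.1 ha).2 k hkw

theorem shift_mono {D : Finset ℕ} {w h : ℕ} {a : Fin w → ℕ} (ha : a ∈ compatible D w h) {k l : ℕ}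
    (hk : 1 ≤ k) (hkl : k ≤ l) (hl : l ≤ w) : shift a k ≤ shift a l := by
  induction l, hkl using Nat.le_induction with
  | base => exact le_rfl
  | succ l hkl ih =>
    have := shift_add_le ha (hk.trans hkl) hl
    have := ih (by omega)
    omega

theorem shift_le {D : Finset ℕ} {w h : ℕ} {a : Fin w → ℕ} (ha : a ∈ compatible D w h) (k : ℕ) :
    shift a k ≤ h := by
  unfold shift
  split_ifs
  · exact (mem_compatible.1 ha).1 _
  · exact Nat.zero_le _

namespace SYT

variable {μ : YoungDiagram}

theorem one_le (S : SYT μ) {c : ℕ × ℕ} (hc : c ∈ μ) : 1 ≤ S.1 c.1 c.2 := (S.2.mapsTo hc).1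

theorem le_card (S : SYT μ) {c : ℕ × ℕ} (hc : c ∈ μ) : S.1 c.1 c.2 ≤ μ.card := (S.2.mapsTo hc).2

theorem eq_of_apply_eq (S : SYT μ) {c d : ℕ × ℕ} (hc : c ∈ μ) (hd : d ∈ μ)
    (h : S.1 c.1 c.2 = S.1 d.1 d.2) : c = d := S.2.injOn hc hd h

theorem exists_cell (S : SYT μ) {k : ℕ} (h1 : 1 ≤ k) (h2 : k ≤ μ.card) :
    ∃ c ∈ μ, S.1 c.1 c.2 = k := by
  obtain ⟨c, hc, h⟩ := S.2.surjOn (Set.mem_Icc.2 ⟨h1, h2⟩)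
  exact ⟨c, hc, h⟩

theorem apply_le_apply (S : SYT μ) {c d : ℕ × ℕ} (hd : d ∈ μ) (h1 : c.1 ≤ d.1) (h2 : c.2 ≤ d.2) :
    S.1 c.1 c.2 ≤ S.1 d.1 d.2 :=
  (S.1.row_weak_of_le h2 (μ.up_left_mem h1 le_rfl hd)).trans (S.1.col_weak h1 hd)

/-- If there are no descents between two entries, then the larger one is not in a lower row. -/
theorem row_le_of_forall_notMem_descents (S : SYT μ) {c d : ℕ × ℕ} (hc : c ∈ μ) (hd : d ∈ μ)
    (hcd : S.1 c.1 c.2 ≤ S.1 d.1 d.2)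
    (h : ∀ k, S.1 c.1 c.2 ≤ k → k < S.1 d.1 d.2 → k ∉ descents S) : d.1 ≤ c.1 := by
  obtain ⟨l, hl⟩ : ∃ l, S.1 d.1 d.2 = l := ⟨_, rfl⟩
  rw [hl] at hcd h
  induction l, hcd using Nat.le_induction generalizing d with
  | base => rw [S.eq_of_apply_eq hd hc hl]
  | succ l hcl ih =>
    have h1 := S.one_le hc
    have h2 := S.le_card hd
    obtain ⟨e, he, hel⟩ := S.exists_cell (k := l) (by omega) (by omega)
    refine le_trans (not_lt.1 fun hlt => ?_)
      (ih he (fun k hk hkl => h k hk (hkl.trans (Nat.lt_succ_self l))) hel)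
    exact h l hcl (Nat.lt_succ_self l) (Finset.mem_filter.2
      ⟨Finset.mem_Icc.2 ⟨by omega, by omega⟩, e, he, d, hd, hel, hl, hlt⟩)

/-- Columns stay strict under substitution: on the way from an entry to an entry in a lower row there
is a descent. -/
theorem shift_lt_shift (S : SYT μ) {h : ℕ} {a : Fin μ.card → ℕ}
    (ha : a ∈ compatible (descents S) μ.card h) {c d : ℕ × ℕ} (hc : c ∈ μ) (hd : d ∈ μ)
    (hcd : S.1 c.1 c.2 ≤ S.1 d.1 d.2) (hrow : c.1 < d.1) :
    shift a (S.1 c.1 c.2) < shift a (S.1 d.1 d.2) := by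
  by_contra hlt
  refine absurd hrow (not_lt.2 (S.row_le_of_forall_notMem_descents hc hd hcd fun k hk hkd hD => ?_))
  have h1 := S.one_le hc
  have h2 := S.le_card hd
  have h3 := shift_add_le ha (k := k) (by omega) (by omega)
  have h4 := shift_mono ha h1 hk (by omega)
  have h5 := shift_mono ha (k := k + 1) (by omega) hkd h2
  rw [if_pos hD] at h3
  omega

/-- The semistandard tableau obtained by replacing, in a standard tableau, the entry `i` by the
`i`-th term of a compatible sequence. -/
def substitute (S : SYT μ) {h : ℕ} {a : Fin μ.card → ℕ}
    (ha : a ∈ compatible (descents S) μ.card h) : SSYTBelow (h + 1) μ :=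
  ⟨{ entry := fun i j => if (i, j) ∈ μ then shift a (S.1 i j) else 0
     row_weak' := by
      intro i j1 j2 hj hc
      have hc1 := μ.up_left_mem le_rfl hj.le hc
      rw [if_pos hc, if_pos hc1]
      exact shift_mono ha (S.one_le hc1) (S.1.row_weak hj hc) (S.le_card hc)
     col_strict' := by
      intro i1 i2 j hi hc
      have hc1 := μ.up_left_mem hi.le le_rfl hc
      rw [if_pos hc, if_pos hc1]
      exact S.shift_lt_shift ha hc1 hc (S.1.col_strict hi hc).le hi
     zeros' := fun hc => if_neg hc }, by
    intro c hc
    change (if _ then _ else 0) < h + 1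
    rw [if_pos ((YoungDiagram.mem_cells _).1 hc)]
    exact Nat.lt_succ_of_le (shift_le ha _)⟩

theorem substitute_apply (S : SYT μ) {h : ℕ} {a : Fin μ.card → ℕ}
    (ha : a ∈ compatible (descents S) μ.card h) {c : ℕ × ℕ} (hc : c ∈ μ) :
    (S.substitute ha).1 c.1 c.2 = shift a (S.1 c.1 c.2) := if_pos hc

theorem sum_substitute (S : SYT μ) {h : ℕ} {a : Fin μ.card → ℕ}
    (ha : a ∈ compatible (descents S) μ.card h) :
    ∑ c ∈ μ.cells, ((S.substitute ha).1 c.1 c.2 : ℤ) = ∑ i, (a i : ℤ) := by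
  symm
  rw [← Finset.sum_coe_sort μ.cells]
  refine Finset.sum_bij' (fun i _ => ⟨(S.exists_cell (k := i + 1) (by omega) i.2).choose,
      (S.exists_cell (k := i + 1) (by omega) i.2).choose_spec.1⟩)
    (fun c _ => ⟨S.1 c.1.1 c.1.2 - 1, by
      have := S.one_le ((YoungDiagram.mem_cells _).1 c.2)
      have := S.le_card ((YoungDiagram.mem_cells _).1 c.2)
      omega⟩) (fun _ _ => Finset.mem_univ _) (fun _ _ => Finset.mem_univ _) ?_ ?_ ?_
  · intro i _
    ext
    simp only [(S.exists_cell (k := i + 1) (by omega) i.2).choose_spec.2]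
    omega
  · intro c _
    have h1 := S.one_le ((YoungDiagram.mem_cells _).1 c.2)
    have h2 := S.le_card ((YoungDiagram.mem_cells _).1 c.2)
    have h3 := S.exists_cell (k := S.1 c.1.1 c.1.2 - 1 + 1) (by omega) (by omega)
    refine Subtype.ext (S.eq_of_apply_eq h3.choose_spec.1 c.2 ?_)
    rw [h3.choose_spec.2]
    omega
  · intro i _
    have h3 := S.exists_cell (k := i + 1) (by omega) i.2
    rw [S.substitute_apply ha h3.choose_spec.1, h3.choose_spec.2, shift_succ]

end SYT

/-- The key by which standardization orders the cells of a semistandard tableau: by their entries,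
and from left to right for equal entries. -/
def cellKey {μ : YoungDiagram} (T : SemistandardYoungTableau μ) (c : ℕ × ℕ) : ℕ ×ₗ ℕ :=
  toLex (T c.1 c.2, c.2)

theorem cellKey_le_iff {μ : YoungDiagram} {T : SemistandardYoungTableau μ} {c d : ℕ × ℕ} :
    cellKey T c ≤ cellKey T d ↔
      T c.1 c.2 < T d.1 d.2 ∨ T c.1 c.2 = T d.1 d.2 ∧ c.2 ≤ d.2 :=
  Prod.Lex.toLex_le_toLex

theorem cellKey_injOn {μ : YoungDiagram} {T : SemistandardYoungTableau μ} {c d : ℕ × ℕ}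
    (hc : c ∈ μ) (hd : d ∈ μ) (h : cellKey T c = cellKey T d) : c = d := by
  obtain ⟨i, j⟩ := c
  obtain ⟨i', j'⟩ := d
  have h1 := Prod.mk.inj (toLex.injective h)
  obtain ⟨h1, rfl⟩ : T i j = T i' j' ∧ j = j' := h1
  rcases lt_trichotomy i i' with hlt | rfl | hlt
  · exact absurd h1 (T.col_strict hlt hd).ne
  · rfl
  · exact absurd h1 (T.col_strict hlt hc).ne'

/-- The position of a cell in the order of `cellKey`, counted from `1`. -/
def cellRank {μ : YoungDiagram} (T : SemistandardYoungTableau μ) (c : ℕ × ℕ) : ℕ :=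
  (μ.cells.filter fun d => cellKey T d ≤ cellKey T c).card

theorem cellRank_lt_cellRank {μ : YoungDiagram} {T : SemistandardYoungTableau μ} {c d : ℕ × ℕ}
    (hd : d ∈ μ) (h : cellKey T c < cellKey T d) : cellRank T c < cellRank T d := by
  refine Finset.card_lt_card ⟨fun e he => ?_, fun hsub => ?_⟩
  · rw [Finset.mem_filter] at he ⊢
    exact ⟨he.1, he.2.trans h.le⟩
  · have h1 := hsub (Finset.mem_filter.2 ⟨(YoungDiagram.mem_cells _).2 hd, le_rfl⟩)
    exact absurd (Finset.mem_filter.1 h1).2 (not_le.2 h)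

theorem cellRank_injOn {μ : YoungDiagram} (T : SemistandardYoungTableau μ) :
    Set.InjOn (cellRank T) (μ.cells : Set (ℕ × ℕ)) := by
  intro c hc d hd h
  rcases lt_trichotomy (cellKey T c) (cellKey T d) with hlt | heq | hlt
  · exact absurd h (cellRank_lt_cellRank hd hlt).ne
  · exact cellKey_injOn hc hd heq
  · exact absurd h (cellRank_lt_cellRank hc hlt).ne'

/-- The standardization of a semistandard tableau numbers the cells in the order of `cellKey`. -/
def standardize {μ : YoungDiagram} (T : SemistandardYoungTableau μ) : SYT μ :=
  ⟨{ entry := fun i j => if (i, j) ∈ μ then cellRank T (i, j) else 0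
     row_weak' := by
      intro i j1 j2 hj hc
      rw [if_pos hc, if_pos (μ.up_left_mem le_rfl hj.le hc)]
      refine (cellRank_lt_cellRank hc ?_).le
      rw [cellKey, cellKey, Prod.Lex.toLex_lt_toLex]
      rcases (T.row_weak hj hc).lt_or_eq with h | h
      · exact Or.inl h
      · exact Or.inr ⟨h, hj⟩
     col_strict' := by
      intro i1 i2 j hi hc
      rw [if_pos hc, if_pos (μ.up_left_mem hi.le le_rfl hc)]
      refine cellRank_lt_cellRank hc ?_
      rw [cellKey, cellKey, Prod.Lex.toLex_lt_toLex]
      exact Or.inl (T.col_strict hi hc)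
     zeros' := fun hc => if_neg hc }, by
    have heq : Set.EqOn (cellRank T)
        (fun c : ℕ × ℕ => if (c.1, c.2) ∈ μ then cellRank T (c.1, c.2) else 0)
        (μ.cells : Set (ℕ × ℕ)) := fun c hc => (if_pos ((YoungDiagram.mem_cells _).1 hc)).symm
    have hmaps : Set.MapsTo (cellRank T) μ.cells (Finset.Icc 1 μ.card) := by
      intro c hc
      rw [Finset.mem_coe, Finset.mem_Icc]
      exact ⟨Finset.card_pos.2 ⟨c, Finset.mem_filter.2 ⟨hc, le_rfl⟩⟩,
        Finset.card_le_card (Finset.filter_subset _ _)⟩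
    have hsurj := Finset.surjOn_of_injOn_of_card_le (cellRank T) hmaps (cellRank_injOn T)
      (by rw [Nat.card_Icc]; exact le_of_eq (Nat.add_sub_cancel _ _))
    rw [Finset.coe_Icc] at hmaps hsurj
    exact Set.BijOn.congr ⟨hmaps, cellRank_injOn T, hsurj⟩ heq⟩

theorem standardize_apply {μ : YoungDiagram} (T : SemistandardYoungTableau μ) {c : ℕ × ℕ}
    (hc : c ∈ μ) : (standardize T).1 c.1 c.2 = cellRank T c := if_pos hc

namespace SYT

variable {μ : YoungDiagram}

theorem card_filter_le (S : SYT μ) {c : ℕ × ℕ} (hc : c ∈ μ) :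
    (μ.cells.filter fun d => S.1 d.1 d.2 ≤ S.1 c.1 c.2).card = S.1 c.1 c.2 := by
  have h1 : (μ.cells.filter fun d => S.1 d.1 d.2 ≤ S.1 c.1 c.2).image (fun d => S.1 d.1 d.2) =
      Finset.Icc 1 (S.1 c.1 c.2) := by
    ext k
    simp only [Finset.mem_image, Finset.mem_filter, Finset.mem_Icc, YoungDiagram.mem_cells]
    constructor
    · rintro ⟨d, ⟨hd, h1⟩, rfl⟩
      exact ⟨S.one_le hd, h1⟩
    · rintro ⟨h1, h2⟩
      obtain ⟨d, hd, rfl⟩ := S.exists_cell h1 (h2.trans (S.le_card hc))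
      exact ⟨d, ⟨hd, h2⟩, rfl⟩
  have h2 := Finset.card_image_of_injOn (f := fun d : ℕ × ℕ => S.1 d.1 d.2)
    (s := μ.cells.filter fun d => S.1 d.1 d.2 ≤ S.1 c.1 c.2)
    fun d hd e he h => S.eq_of_apply_eq
      ((YoungDiagram.mem_cells _).1 (Finset.mem_filter.1 hd).1)
      ((YoungDiagram.mem_cells _).1 (Finset.mem_filter.1 he).1) h
  rw [← h2, h1, Nat.card_Icc, Nat.add_sub_cancel]

/-- A standard tableau orders the cells by the keys of any semistandard tableau obtained from it, so
it can be recovered by standardization. -/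
theorem cellKey_le_of_le (S : SYT μ) {h : ℕ} {a : Fin μ.card → ℕ}
    (ha : a ∈ compatible (descents S) μ.card h) {c d : ℕ × ℕ} (hc : c ∈ μ) (hd : d ∈ μ)
    (hcd : S.1 c.1 c.2 ≤ S.1 d.1 d.2) :
    cellKey (S.substitute ha).1 c ≤ cellKey (S.substitute ha).1 d := by
  rw [cellKey_le_iff, S.substitute_apply ha hc, S.substitute_apply ha hd]
  rcases (shift_mono ha (S.one_le hc) hcd (S.le_card hd)).lt_or_eq with hlt | heq
  · exact Or.inl hlt
  · refine Or.inr ⟨heq, ?_⟩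
    have hrow : d.1 ≤ c.1 := not_lt.1 fun hlt => (S.shift_lt_shift ha hc hd hcd hlt).ne heq
    by_contra hcol
    have h1 := S.apply_le_apply hc hrow (not_le.1 hcol).le
    have h2 := S.eq_of_apply_eq hc hd (le_antisymm hcd h1)
    exact hcol (h2 ▸ le_rfl)

theorem standardize_substitute (S : SYT μ) {h : ℕ} {a : Fin μ.card → ℕ}
    (ha : a ∈ compatible (descents S) μ.card h) : standardize (S.substitute ha).1 = S := by
  apply Subtype.ext
  ext i j
  by_cases hc : (i, j) ∈ μ
  · rw [standardize_apply _ (c := (i, j)) hc, ← S.card_filter_le (c := (i, j)) hc, cellRank]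
    congr 1
    refine Finset.filter_congr fun d hd => ?_
    have hd' := (YoungDiagram.mem_cells _).1 hd
    refine ⟨fun hle => ?_, S.cellKey_le_of_le ha hd' hc⟩
    by_contra hlt
    have h1 := S.cellKey_le_of_le ha hc hd' (not_le.1 hlt).le
    rw [cellKey_injOn hc hd' (le_antisymm h1 hle)] at hlt
    exact hlt le_rfl
  · rw [(standardize _).1.zeros hc, S.1.zeros hc]

end SYT

/-- Every semistandard tableau comes from its standardization. -/
theorem exists_substitute_eq {μ : YoungDiagram} {h : ℕ} (T : SSYTBelow (h + 1) μ) :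
    ∃ (a : Fin μ.card → ℕ) (ha : a ∈ compatible (descents (standardize T.1)) μ.card h),
      (standardize T.1).substitute ha = T := by
  set S := standardize T.1 with hS
  choose cell hcell hS' using fun i : Fin μ.card => S.exists_cell (k := i + 1) (by omega) i.2
  have ha : (fun i => T.1 (cell i).1 (cell i).2) ∈ compatible (descents S) μ.card h := by
    refine mem_compatible.2 ⟨fun i => Nat.lt_succ_iff.1 (T.2 _ (hcell i)), fun i hi => ?_⟩
    set c := cell ⟨i, by omega⟩ with hc
    set d := cell ⟨i + 1, hi⟩ with hd
    have hcμ : c ∈ μ := hcell _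
    have hdμ : d ∈ μ := hcell _
    have hSc : S.1 c.1 c.2 = i + 1 := hS' _
    have hSd : S.1 d.1 d.2 = i + 1 + 1 := hS' _
    have hkey : cellKey T.1 c ≤ cellKey T.1 d := by
      by_contra hlt
      have h1 := cellRank_lt_cellRank hcμ (not_le.1 hlt)
      rw [← standardize_apply _ hcμ, ← standardize_apply _ hdμ, ← hS, hSc, hSd] at h1
      omega
    rw [cellKey_le_iff] at hkey
    split_ifs with hD
    · obtain ⟨-, c', hc', d', hd', h1, h2, hlt⟩ := Finset.mem_filter.1 hD
      rw [S.eq_of_apply_eq hc' hcμ (h1.trans hSc.symm),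
        S.eq_of_apply_eq hd' hdμ (h2.trans hSd.symm)] at hlt
      rcases hkey with hkey | ⟨heq, hcol⟩
      · exact hkey
      · have h3 := T.1.row_weak_of_le hcol (μ.up_left_mem hlt.le le_rfl hdμ)
        exact h3.trans_lt (T.1.col_strict hlt hdμ)
    · rcases hkey with hkey | hkey
      · exact hkey.le
      · exact hkey.1.le
  refine ⟨_, ha, Subtype.ext ?_⟩
  ext i j
  by_cases hc : (i, j) ∈ μ
  · rw [S.substitute_apply ha (c := (i, j)) hc]
    have h1 : 1 ≤ S.1 i j := S.one_le hc
    have h2 : S.1 i j ≤ μ.card := S.le_card hc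
    change shift _ (S.1 i j) = _
    rw [shift, dif_pos (by omega)]
    have h3 := S.eq_of_apply_eq (hcell ⟨S.1 i j - 1, by omega⟩) hc
      ((hS' _).trans (Nat.sub_add_cancel h1))
    simp only [h3]
  · rw [(S.substitute ha).1.zeros hc, T.1.zeros hc]

theorem principalSchur_eq_sum (μ : YoungDiagram) (h : ℕ) :
    principalSchur μ h = ∑ S : SYT μ, ∑ a ∈ compatible (descents S) μ.card h,
      qPow (2 * ∑ i, (a i : ℤ) - h * μ.card) := by
  rw [principalSchur, Finset.sum_sigma']
  symm
  refine Finset.sum_bij (fun p hp => p.1.substitute (Finset.mem_sigma.1 hp).2)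
    (fun _ _ => Finset.mem_univ _) ?_ ?_ ?_
  · rintro ⟨S, a⟩ hp ⟨S', a'⟩ hp' heq
    have ha := (Finset.mem_sigma.1 hp).2
    have ha' := (Finset.mem_sigma.1 hp').2
    dsimp only at heq ha ha'
    obtain rfl : S = S' := by
      rw [← S.standardize_substitute ha, heq, S'.standardize_substitute ha']
    congr 1
    ext i
    obtain ⟨c, hc, hci⟩ := S.exists_cell (k := i + 1) (by omega) i.2
    rw [← shift_succ a, ← shift_succ a', ← hci, ← S.substitute_apply ha hc, heq,
      S.substitute_apply ha' hc]
  · intro T _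
    obtain ⟨a, ha, hT⟩ := exists_substitute_eq T
    exact ⟨⟨_, a⟩, Finset.mem_sigma.2 ⟨Finset.mem_univ _, ha⟩, hT⟩
  · rintro ⟨S, a⟩ hp
    simp only [S.sum_substitute]

/-! ### Generating functions of compatible sequences -/

open PowerSeries

/-- The series `∑_h z^h ∑_a q ^ (2 (a₁ + ⋯ + a_w))` over the compatible sequences. -/
noncomputable def compatibleSeries (D : Finset ℕ) (w : ℕ) : PowerSeries (LaurentPolynomial ℤ) :=
  PowerSeries.mk fun h => ∑ a ∈ compatible D w h, qPow (2 * ∑ i, (a i : ℤ))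

theorem compatibleSeries_zero (D : Finset ℕ) : compatibleSeries D 0 = PowerSeries.mk 1 := by
  ext1 h
  have h1 : compatible D 0 h = {Fin.elim0} := by
    ext a
    rw [mem_compatible, Finset.mem_singleton]
    exact ⟨fun _ => Subsingleton.elim _ _, fun _ => ⟨fun i => i.elim0, fun i hi => by omega⟩⟩
  rw [compatibleSeries, coeff_mk, coeff_mk, h1]
  simp

/-- A compatible sequence is a shorter one followed by a last term `m`; the terms of the shorter
one are at most `m`, and less than `m` if `w ∈ D`. -/
theorem snoc_mem_compatible {D : Finset ℕ} (hD : 0 ∉ D) {w h m : ℕ} {b : Fin w → ℕ} :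
    (Fin.snoc b m : Fin (w + 1) → ℕ) ∈ compatible D (w + 1) h ↔
      m ≤ h ∧ if w ∈ D then 1 ≤ m ∧ b ∈ compatible D w (m - 1) else b ∈ compatible D w m := by
  have hcast (i : ℕ) (hi : i < w) :
      (Fin.snoc b m : Fin (w + 1) → ℕ) ⟨i, by omega⟩ = b ⟨i, hi⟩ :=
    Fin.snoc_castSucc (α := fun _ => ℕ) m b ⟨i, hi⟩
  have hlast : (Fin.snoc b m : Fin (w + 1) → ℕ) ⟨w, by omega⟩ = m :=
    Fin.snoc_last (α := fun _ => ℕ) m b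
  constructor
  · intro ha
    rw [mem_compatible] at ha
    obtain ⟨h1, h2⟩ := ha
    have hb : b ∈ compatible D w h := by
      refine mem_compatible.2 ⟨fun i => ?_, fun i hi => ?_⟩
      · rw [← hcast i i.2]
        exact h1 _
      · rw [← hcast, ← hcast]
        exact h2 i (by omega)
    have hbound (i : Fin w) : b i + (if w ∈ D then 1 else 0) ≤ m := by
      have hi := i.2
      have h3 := h2 (w - 1) (by omega)
      have h4 := shift_mono hb (k := i + 1) (l := w - 1 + 1) (by omega) (by omega) (by omega)
      rw [shift_succ, shift, dif_pos (by omega)] at h4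
      simp only [show w - 1 + 1 - 1 = w - 1 from rfl] at h4
      rw [hcast (w - 1) (by omega)] at h3
      simp only [Nat.sub_add_cancel (show 1 ≤ w by omega), hlast] at h3
      omega
    have hchain := (mem_compatible.1 hb).2
    refine ⟨by rw [← hlast]; exact h1 _, ?_⟩
    split_ifs with hw
    · simp only [if_pos hw] at hbound
      have hw0 : 0 < w := Nat.pos_of_ne_zero fun h0 => hD (h0 ▸ hw)
      have := hbound ⟨0, hw0⟩
      refine ⟨by omega, mem_compatible.2 ⟨fun i => ?_, hchain⟩⟩
      have := hbound i
      omega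
    · simp only [if_neg hw] at hbound
      exact mem_compatible.2 ⟨hbound, hchain⟩
  · rintro ⟨hm, hb⟩
    have hb' : (∀ i, b i + (if w ∈ D then 1 else 0) ≤ m) ∧ ∀ (i : ℕ) (hi : i + 1 < w),
        b ⟨i, by omega⟩ + (if i + 1 ∈ D then 1 else 0) ≤ b ⟨i + 1, hi⟩ := by
      split_ifs at hb ⊢ with hw
      · rw [mem_compatible] at hb
        refine ⟨fun i => ?_, hb.2.2⟩
        have := hb.2.1 i
        omega
      · exact mem_compatible.1 hb
    obtain ⟨h1, h2⟩ := hb'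
    refine mem_compatible.2 ⟨fun i => ?_, fun i hi => ?_⟩
    · induction i using Fin.lastCases with
      | last => rwa [Fin.snoc_last]
      | cast i =>
        rw [Fin.snoc_castSucc]
        have := h1 i
        omega
    · rw [hcast i (by omega)]
      rcases (show i + 1 ≤ w by omega).lt_or_eq with hlt | heq
      · rw [hcast (i + 1) hlt]
        exact h2 i hlt
      · subst heq
        rw [hlast]
        exact h1 _

theorem compatibleSeries_succ {D : Finset ℕ} (hD : 0 ∉ D) (w : ℕ) :
    compatibleSeries D (w + 1) = PowerSeries.mk 1 *
      rescale (qPow 2) ((if w ∈ D then X else 1) * compatibleSeries D w) := by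
  have hcoeff (m : ℕ) :
      coeff m (rescale (qPow 2) ((if w ∈ D then X else 1) * compatibleSeries D w)) =
        ∑ b ∈ if w ∈ D then (if m = 0 then ∅ else compatible D w (m - 1)) else compatible D w m,
          qPow (2 * (∑ i, (b i : ℤ) + m)) := by
    have hsum (s : Finset (Fin w → ℕ)) : ∑ b ∈ s, qPow (2 * (∑ i, (b i : ℤ) + m)) =
        qPow 2 ^ m * ∑ b ∈ s, qPow (2 * ∑ i, (b i : ℤ)) := by
      rw [Finset.mul_sum]
      refine Finset.sum_congr rfl fun b _ => ?_
      rw [qPow_pow, ← qPow_add]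
      congr 1
      ring
    rw [coeff_rescale, hsum]
    congr 1
    split_ifs with hw hm
    · subst hm
      simp
    · obtain ⟨m, rfl⟩ := Nat.exists_eq_succ_of_ne_zero hm
      rw [Nat.succ_eq_add_one, coeff_succ_X_mul, compatibleSeries, coeff_mk, Nat.add_sub_cancel]
    · rw [one_mul, compatibleSeries, coeff_mk]
  ext1 h
  rw [coeff_mul, Finset.Nat.sum_antidiagonal_eq_sum_range_succ_mk, ← Finset.sum_range_reflect]
  simp only [coeff_mk, Pi.one_apply, one_mul]
  have hrefl : ∀ m ∈ Finset.range (h + 1),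
      coeff (h - (h + 1 - 1 - m))
        (rescale (qPow 2) ((if w ∈ D then X else 1) * compatibleSeries D w)) =
      ∑ b ∈ if w ∈ D then (if m = 0 then ∅ else compatible D w (m - 1)) else compatible D w m,
          qPow (2 * (∑ i, (b i : ℤ) + m)) := by
    intro m hm
    rw [Finset.mem_range] at hm
    rw [show h - (h + 1 - 1 - m) = m by omega, hcoeff]
  rw [Nat.succ_eq_add_one, Finset.sum_congr rfl hrefl, Finset.sum_sigma', compatibleSeries, coeff_mk]
  refine Finset.sum_bij' (fun a _ => ⟨a (Fin.last w), Fin.init a⟩)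
    (fun p _ => Fin.snoc p.2 p.1) ?_ ?_ ?_ ?_ ?_
  · intro a ha
    rw [← Fin.snoc_init_self a, snoc_mem_compatible hD] at ha
    rw [Finset.mem_sigma, Finset.mem_range]
    refine ⟨Nat.lt_succ_of_le ha.1, ?_⟩
    dsimp only
    split_ifs at ha ⊢ with h1 h2
    · omega
    · exact ha.2.2
    · exact ha.2
  · rintro ⟨m, b⟩ hp
    rw [Finset.mem_sigma, Finset.mem_range] at hp
    obtain ⟨h1, h2⟩ := hp
    rw [snoc_mem_compatible hD]
    dsimp only at h1 h2
    refine ⟨Nat.lt_succ_iff.1 h1, ?_⟩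
    split_ifs at h2 ⊢ with h3 h4
    · simp at h2
    · exact ⟨Nat.pos_of_ne_zero h4, h2⟩
    · exact h2
  · intro a _
    exact Fin.snoc_init_self a
  · rintro ⟨m, b⟩ _
    simp
  · intro a _
    rw [Fin.sum_univ_castSucc]
    rfl

theorem rescale_C_mul_X (m n : ℤ) :
    rescale (qPow m) (C (qPow n) * X) = C (qPow (n + m)) * X := by
  rw [map_mul, rescale_X, qPow_add, map_mul, mul_assoc]
  congr 1
  ext k
  rw [coeff_rescale, coeff_C]
  split_ifs with hk
  · simp [hk]
  · simp

theorem compatibleSeries_mul {D : Finset ℕ} (hD : 0 ∉ D) (w : ℕ) :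
    compatibleSeries D w * ∏ i ∈ Finset.range (w + 1), (1 - C (qPow (2 * (i : ℤ))) * X) =
      ∏ j ∈ Finset.range w, if j ∈ D then C (qPow (2 * ((w : ℤ) - j))) * X else 1 := by
  have hgeom : (PowerSeries.mk 1 : PowerSeries (LaurentPolynomial ℤ)) * (1 - X) = 1 :=
    mk_one_mul_one_sub_eq_one _
  induction w with
  | zero => simpa [compatibleSeries_zero] using hgeom
  | succ w ih =>
    have h1 : ∏ i ∈ Finset.range (w + 1 + 1), (1 - C (qPow (2 * (i : ℤ))) * X) =
        rescale (qPow 2) (∏ i ∈ Finset.range (w + 1), (1 - C (qPow (2 * (i : ℤ))) * X)) *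
          (1 - X) := by
      rw [Finset.prod_range_succ', map_prod]
      simp only [map_sub, map_one, rescale_C_mul_X]
      refine congrArg₂ (· * ·) ?_ ?_
      · refine Finset.prod_congr rfl fun i _ => ?_
        push_cast
        rw [mul_add, mul_one]
      · simp
    have h2 : (∏ j ∈ Finset.range (w + 1),
          if j ∈ D then C (qPow (2 * (((w + 1 : ℕ) : ℤ) - j))) * X else 1) =
        rescale (qPow 2) ((if w ∈ D then X else 1) *
          ∏ j ∈ Finset.range w, if j ∈ D then C (qPow (2 * ((w : ℤ) - j))) * X else 1) := by
      rw [Finset.prod_range_succ, mul_comm, map_mul, map_prod]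
      congr 1
      · split_ifs
        · rw [rescale_X]
          congr 3
          push_cast
          ring
        · rw [map_one]
      · refine Finset.prod_congr rfl fun j _ => ?_
        split_ifs
        · rw [rescale_C_mul_X]
          congr 3
          push_cast
          ring
        · rw [map_one]
    rw [compatibleSeries_succ hD, h1, h2, ← ih, ← mul_assoc, map_mul, map_mul, map_mul]
    linear_combination (rescale (qPow 2) (if w ∈ D then X else 1) *
      rescale (qPow 2) (compatibleSeries D w) *
      rescale (qPow 2) (∏ i ∈ Finset.range (w + 1), (1 - C (qPow (2 * (i : ℤ))) * X))) * hgeom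

theorem denominator_eq_rescale (w : ℕ) :
    denominator w = rescale (qPow (-w))
      (∏ i ∈ Finset.range (w + 1), (1 - C (qPow (2 * (i : ℤ))) * X)) := by
  rw [denominator, map_prod, ← Finset.prod_range_reflect]
  refine Finset.prod_congr rfl fun i hi => ?_
  rw [Finset.mem_range] at hi
  rw [map_sub, map_one, rescale_C_mul_X]
  congr 4
  rw [Nat.add_sub_cancel, Nat.cast_sub (by omega)]
  ring

theorem SYT.pos_and_lt_card_of_mem_descents {μ : YoungDiagram} (S : SYT μ) {k : ℕ}
    (hk : k ∈ descents S) : 1 ≤ k ∧ k < μ.card := by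
  obtain ⟨h1, c, -, d, hd, -, h2, -⟩ := Finset.mem_filter.1 hk
  have h3 := S.le_card hd
  exact ⟨(Finset.mem_Icc.1 h1).1, by omega⟩

theorem mk_principalSchur_mul_denominator (μ : YoungDiagram) :
    PowerSeries.mk (principalSchur μ) * denominator μ.card = numerator μ := by
  have h1 : PowerSeries.mk (principalSchur μ) =
      ∑ S : SYT μ, rescale (qPow (-μ.card)) (compatibleSeries (descents S) μ.card) := by
    ext1 h
    rw [coeff_mk, principalSchur_eq_sum, map_sum]
    refine Finset.sum_congr rfl fun S _ => ?_
    rw [coeff_rescale, compatibleSeries, coeff_mk, Finset.mul_sum]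
    refine Finset.sum_congr rfl fun a _ => ?_
    rw [qPow_pow, ← qPow_add]
    congr 1
    ring
  rw [h1, Finset.sum_mul, numerator]
  refine Finset.sum_congr rfl fun S _ => ?_
  have h0 : 0 ∉ descents S := fun h => by
    have := S.pos_and_lt_card_of_mem_descents h
    omega
  have hsub : descents S ⊆ Finset.range μ.card := fun k hk =>
    Finset.mem_range.2 (S.pos_and_lt_card_of_mem_descents hk).2
  rw [denominator_eq_rescale, ← map_mul, compatibleSeries_mul h0, Finset.prod_ite_mem,
    Finset.inter_eq_right.2 hsub, map_prod]
  simp only [rescale_C_mul_X]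
  rw [Finset.prod_mul_distrib, Finset.prod_const, ← map_prod, prod_qPow, mul_pow, ← map_pow,
    qPow_pow, mul_left_comm, ← map_mul, ← qPow_add, mul_comm, des, maj]
  congr 3
  rw [Nat.cast_sum, Finset.mul_sum, Finset.card_eq_sum_ones, Nat.cast_sum, Finset.sum_mul,
    ← Finset.sum_add_distrib]
  refine Finset.sum_congr rfl fun j _ => ?_
  push_cast
  ring

end QuantumEhrhart

theorem mainTheorem6 (μ : YoungDiagram) (Q : QuantumEhrhart.SYT μ) :
    QuantumEhrhart.quantumEhrhartSeries (QuantumEhrhart.coarseChamber Q)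
        = PowerSeries.mk (fun h => QuantumEhrhart.sl2Plethysm μ h) ∧
      PowerSeries.mk (fun h => QuantumEhrhart.sl2Plethysm μ h)
        = QuantumEhrhart.numerator μ *
            PowerSeries.invOfUnit (QuantumEhrhart.denominator μ.card) 1 := by
  have h1 (h : ℕ) := QuantumEhrhart.sl2Plethysm_eq μ h
  refine ⟨?_, ?_⟩
  · rw [QuantumEhrhart.quantumEhrhartSeries]
    congr 1
    funext h
    rw [QuantumEhrhart.quantumEhrhart_coarseChamber, h1]
  · rw [← QuantumEhrhart.mk_principalSchur_mul_denominator, mul_assoc,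
      QuantumEhrhart.denominator_mul_invOfUnit, mul_one]
    congr 1
    funext h
    exact h1 h
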